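/- Let $n\ge 1$. Let $Q_n$ be the double of the $A_n$ quiver with one loop at each vertex $1,\dots,n$: its arrows are the loops $a_{2v-1}$ at $v$ ($1\le v\le n$), and $a_{2v}\colon v\to v+1$, $b_{2v}\colon v+1\to v$ ($1\le v\le n-1$). Let $b_{2v-1}$ be the trivial path at $v$, and put $\mathsf x_i=a_ib_i$, $\mathsf x_i'=b_ia_i$ for $1\le i\le 2n-1$. Let $\mathsf M$ be the set of all families $k=(k_{ij})_{1\le i\le 2n-1,\ j\ge 2}$ of complex numbers; $k\in\mathsf M$ defines the monomialised Type $A$ potential $$f(k)=\sum_{i=1}^{2n-2}\mathsf x_i'\mathsf x_{i+1}+\sum_{i=1}^{2n-1}\sum_{j\ge2}k_{ij}\mathsf x_i^{\,j}.$$ *Generalised GV invariants.* For $0\le e\le 2n-1$ let $g_0,\dots,g_{2n}\in(x,y)\subset\mathbb C[[x,y]]$ be the solution of $$g_{i-1}+\sum_{j\ge2}jk_{ij}\,g_i^{\,j-1}+g_{i+1}=0\quad(1\le i\le 2n-1),\qquad g_e=y,\quad g_{e+1}=x,$$ and for $1\le s\le t\le n$ put $N_{st}(f(k))=\dim_{\mathbb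 C}\mathbb C[[x,y]]/(g_{2s-2},g_{2t})\in\mathbb N\cup\{\infty\}$. All assertions below hold for every choice of $e$. *Matrices.* Put $\varepsilon_{ij}=jk_{ij}$. For square matrices $A=(a_{uv})_{1\le u,v\le q}$ and $B=(b_{uv})$ with $a_{qq}=b_{11}$, let $A\oblong B$ be the block-diagonal gluing in which the entries $a_{qq}$ and $b_{11}$ are identified and all entries outside the two blocks are $0$. Put $A_{ii}^d=[\varepsilon_{id}]$, $A^2_{i,i+1}=\begin{bmatrix}\varepsilon_{i2}&1\\1&\varepsilon_{i+1,2}\end{bmatrix}$ and $A^2_{ij}=A^2_{i,i+1}\oblong A^2_{i+1,i+2}\oblong\cdots\oblong A^2_{j-1,j}$. For $d>2$ let $A^d_{i,i+2}$ be the $(d+1)\times(d+1)$ matrix, with rows and columns numbered $0,\dots,d$, whose only non-zero entries are: $\varepsilon_{id}$ at $(0,0)$ and $1$ at $(0,d-1)$; $1$ at $(r,r-1)$ and $(r,r)$ for $1\le r\le d-2$; $1$ at $(d-1,d-2)$ and $(d-1,d)$; $1$ at $(d,d-1)$ and $\varepsilon_{i+2,d}$ at $(d,d)$. For $d>2$ and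 $j-i$ even put $A^d_{ij}=A^d_{i,i+2}\oblong A^d_{i+2,i+4}\oblong\cdots\oblong A^d_{j-2,j}$. Write $A^d_{ij}(f(k))$ for the matrix attached to $k$. **Theorem.** Fix $\mathbf p=(p_1,\dots,p_{2n-1})$ with $p_i\in\mathbb N\cup\{\infty\}$, $p_i\ge2$, and integers $1\le s\le t\le n$. Let $$\mathsf M_{\mathbf p}=\{k\in\mathsf M\mid k_{ij}=0\text{ whenever }2\le j<p_i\},\qquad d=d_{2s-1,2t-1}(\mathbf p)=\min(p_{2s-1},p_{2s+1},\dots,p_{2t-1}).$$ If $d$ is finite, then there is a filtration $\mathsf M_{\mathbf p}=M_1\supsetneq M_2\supsetneq M_3\supsetneq\cdots$ such that: 1. for each $i\ge1$, $N_{st}(f(k))=d+i-2$ for all $k\in M_i\setminus M_{i+1}$; 2. each $M_i$ is the common zero locus in $\mathsf M_{\mathbf p}$ of finitely many power series, in fact polynomials, in the coordinates $\kappa_{ij}$ ($1\le i\le 2n-1$, $p_i\le j<\infty$) of $\mathsf M_{\mathbf p}$; moreover $M_2=\{k\in\mathsf M_{\mathbf p}\mid\det A^d_{2s-1,2t-1}(f(k))=0\}$;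 3. if $s=t$, then for each $i\ge2$, $M_i=\{k\in\mathsf M_{\mathbf p}\mid k_{2s-1,j}=0\text{ for }p_{2s-1}\le j\le p_{2s-1}+i-2\}$. If $d$ is infinite, then $N_{st}(f(k))=\infty$ for all $k\in\mathsf M_{\mathbf p}$. -/

import Mathlib

namespace TypeA

/-! ### The quiver `Q_n` and monomialised Type A potentials -/

/-- The indices `1 ≤ i ≤ 2n - 1`. -/
abbrev Idx (n : ℕ) : Type := {i : ℕ // 1 ≤ i ∧ i < 2 * n}

/-- The vertices `1, …, n` of `Q_n`. -/
def Vertex (n : ℕ) : Type := {v : ℕ // 1 ≤ v ∧ v ≤ n}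

/-- The arrows of `Q_n`: the arrows `a_i` for `1 ≤ i ≤ 2n - 1`, where `a_{2v-1}` is the loop at the
vertex `v` and `a_{2v} : v → v + 1`, and the arrows `b_{2v} : v + 1 → v`. -/
inductive Arrow (n : ℕ) : Type
  | a (i : Idx n) : Arrow n
  | b (i : Idx n) (hi : Even i.1) : Arrow n

/-- The tail of `a_i`: the vertex `v` if `i = 2v - 1` or `i = 2v`. -/
def leftEnd {n : ℕ} (i : Idx n) : Vertex n :=
  ⟨(i.1 + 1) / 2, by have := i.2; omega, by have := i.2; omega⟩

/-- The head of `a_i`: the vertex `v` if `i = 2v - 1`, and `v + 1` if `i = 2v`. -/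
def rightEnd {n : ℕ} (i : Idx n) : Vertex n :=
  ⟨i.1 / 2 + 1, by omega, by have := i.2; omega⟩

def Arrow.tail {n : ℕ} : Arrow n → Vertex n
  | .a i => leftEnd i
  | .b i _ => rightEnd i

def Arrow.head {n : ℕ} : Arrow n → Vertex n
  | .a i => rightEnd i
  | .b i _ => leftEnd i

/-- The quiver `Q_n`: the double of the `A_n` quiver, with one loop at each vertex. -/
instance quiverQ (n : ℕ) : Quiver (Vertex n) where
  Hom u v := {α : Arrow n // α.tail = u ∧ α.head = v}

/-- The path of length one given by `a_i`. -/
def aPath {n : ℕ} (i : Idx n) : Quiver.Path (leftEnd i) (rightEnd i) :=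
  Quiver.Hom.toPath (V := Vertex n) ⟨Arrow.a i, rfl, rfl⟩

theorem rightEnd_eq_leftEnd {n : ℕ} {i : Idx n} (hi : ¬ Even i.1) : rightEnd i = leftEnd i := by
  apply Subtype.ext
  have := Nat.not_even_iff.1 hi
  simp only [rightEnd, leftEnd]
  omega

/-- The path `b_i`: the trivial path at the vertex `v` if `i = 2v - 1`, and otherwise the path of
length one given by the arrow `b_i`. -/
def bPath {n : ℕ} (i : Idx n) : Quiver.Path (rightEnd i) (leftEnd i) :=
  if hi : Even i.1 then Quiver.Hom.toPath (V := Vertex n) ⟨Arrow.b i hi, rfl, rfl⟩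
  else (Quiver.Path.nil : Quiver.Path (leftEnd i) (leftEnd i)).cast
    (rightEnd_eq_leftEnd hi).symm rfl

/-- `x_i = a_i b_i` (paths are composed from left to right). -/
def xPath {n : ℕ} (i : Idx n) : Quiver.Path (leftEnd i) (leftEnd i) := (aPath i).comp (bPath i)

/-- `x_i' = b_i a_i`. -/
def xPath' {n : ℕ} (i : Idx n) : Quiver.Path (rightEnd i) (rightEnd i) := (bPath i).comp (aPath i)

/-- The powers of a cyclic path. -/
def pathPow {V : Type} [Quiver V] {v : V} (c : Quiver.Path v v) : ℕ → Quiver.Path v v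
  | 0 => Quiver.Path.nil
  | m + 1 => (pathPow c m).comp c

/-- Cyclic paths in `Q_n`. -/
abbrev CyclicPath (n : ℕ) : Type := Σ v : Vertex n, Quiver.Path v v

/-- Potentials on `Q_n`: possibly infinite complex linear combinations of cyclic paths, given by
their coefficients. -/
abbrev Potential (n : ℕ) : Type := CyclicPath n → ℂ

/-- The index `i + 1`, for `1 ≤ i ≤ 2n - 2`. -/
def succIdx {n : ℕ} (i : Idx n) (hi : i.1 + 1 < 2 * n) : Idx n := ⟨i.1 + 1, by omega, hi⟩

theorem leftEnd_succIdx {n : ℕ} (i : Idx n) (hi : i.1 + 1 < 2 * n) :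
    leftEnd (succIdx i hi) = rightEnd i :=
  Subtype.ext (by simp only [leftEnd, rightEnd, succIdx]; omega)

/-- The cyclic path `x_i' x_{i+1}`, for `1 ≤ i ≤ 2n - 2`. -/
def crossPath {n : ℕ} (i : {i : Idx n // i.1 + 1 < 2 * n}) : CyclicPath n :=
  ⟨rightEnd i.1, (xPath' i.1).comp
    ((xPath (succIdx i.1 i.2)).cast
      (leftEnd_succIdx i.1 i.2) (leftEnd_succIdx i.1 i.2))⟩

/-- The cyclic path `x_i ^ j`. -/
def powPath {n : ℕ} (i : Idx n) (j : ℕ) : CyclicPath n := ⟨leftEnd i, pathPow (xPath i) j⟩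

/-- The indices `(i, j)` with `1 ≤ i ≤ 2n - 1` and `j ≥ 2` of the coordinates `k_{ij}`. -/
abbrev Coord (n : ℕ) : Type := {c : Idx n × ℕ // 2 ≤ c.2}

/-- The parameter space `M` of all tuples `(k_{ij})`. -/
abbrev Param (n : ℕ) : Type := Coord n → ℂ

open Classical in
/-- The monomialised Type A potential
`f(k) = ∑_{i=1}^{2n-2} x_i' x_{i+1} + ∑_{i=1}^{2n-1} ∑_{j ≥ 2} k_{ij} x_i ^ j`.
For each cyclic path `w` only finitely many summands below are non-zero. -/
noncomputable def potential {n : ℕ} (k : Param n) : Potential n := fun w =>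
  (∑ᶠ i : {i : Idx n // i.1 + 1 < 2 * n}, if crossPath i = w then (1 : ℂ) else 0) +
    ∑ᶠ c : Coord n, if powPath c.1.1 c.1.2 = w then k c else 0

/-- The coefficient `k_{ij}` of `x_i ^ j` in a potential, for `1 ≤ i ≤ 2n - 1` and `j ≥ 2` (and `0`
for all other `i` and `j`). -/
def Potential.coeff {n : ℕ} (f : Potential n) (i j : ℕ) : ℂ :=
  if h : (1 ≤ i ∧ i < 2 * n) ∧ 2 ≤ j then f (powPath ⟨i, h.1⟩ j) else 0

/-! The monomials of a monomialised Type A potential are pairwise different, so that `f(k)` has the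
coefficients `k_{ij}`. -/

def Arrow.idx {n : ℕ} : Arrow n → ℕ
  | .a i => i.1
  | .b i _ => i.1

/-- The list of the indices of the arrows of a path. -/
def labels {n : ℕ} {u : Vertex n} : {v : Vertex n} → Quiver.Path u v → List ℕ
  | _, .nil => []
  | _, .cons p e => labels p ++ [e.1.idx]

theorem labels_comp {n : ℕ} {u v w : Vertex n} (p : Quiver.Path u v) (q : Quiver.Path v w) :
    labels (p.comp q) = labels p ++ labels q := by
  induction q with
  | nil => simp [labels]
  | cons q e ih => simp [labels, ih]

theorem labels_cast {n : ℕ} {u v u' v' : Vertex n} (hu : u = u') (hv : v = v')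
    (p : Quiver.Path u v) : labels (p.cast hu hv) = labels p := by
  subst hu hv
  rfl

theorem labels_aPath {n : ℕ} (i : Idx n) : labels (aPath i) = [i.1] := rfl

theorem labels_bPath {n : ℕ} (i : Idx n) :
    labels (bPath i) = if Even i.1 then [i.1] else [] := by
  unfold bPath
  split_ifs with h
  · rfl
  · rw [labels_cast]; rfl

theorem labels_pathPow {n : ℕ} {i : Idx n} (j : ℕ) :
    labels (pathPow (xPath i) j) = List.replicate (j * (if Even i.1 then 2 else 1)) i.1 := by
  induction j with
  | zero => simp [pathPow, labels]
  | succ j ih =>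
    rw [pathPow, labels_comp, ih, xPath, labels_comp, labels_aPath, labels_bPath]
    split_ifs
    · exact (List.replicate_append_replicate (n := j * 2) (m := 2)).trans
        (congrArg (fun m => List.replicate m i.1) (by omega))
    · exact (List.replicate_append_replicate (n := j * 1) (m := 1)).trans
        (congrArg (fun m => List.replicate m i.1) (by omega))

theorem powPath_inj {n : ℕ} {c c' : Coord n} (h : powPath c.1.1 c.1.2 = powPath c'.1.1 c'.1.2) :
    c = c' := by
  have h1 : labels (powPath c.1.1 c.1.2).2 = labels (powPath c'.1.1 c'.1.2).2 := by rw [h]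
  obtain ⟨⟨i, j⟩, hj⟩ := c
  obtain ⟨⟨i', j'⟩, hj'⟩ := c'
  simp only [powPath, labels_pathPow] at h1 hj hj'
  rw [List.replicate_inj] at h1
  obtain ⟨h2, h3⟩ := h1
  have hi : i = i' := by
    rcases h3 with h3 | h3
    · split_ifs at h3 <;> omega
    · exact Subtype.ext h3
  subst hi
  have : j = j' := by split_ifs at h2 <;> omega
  subst this
  rfl

theorem crossPath_ne {n : ℕ} (i : {i : Idx n // i.1 + 1 < 2 * n}) (i' : Idx n) (j : ℕ) :
    crossPath i ≠ powPath i' j := by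
  intro h
  have h1 : labels (crossPath i).2 = labels (powPath i' j).2 := by rw [h]
  simp only [crossPath, powPath, labels_pathPow, labels_comp] at h1
  rw [labels_cast, xPath', xPath, labels_comp, labels_comp, labels_aPath, labels_aPath] at h1
  have h2 : i.1.1 ∈ List.replicate (j * (if Even i'.1 then 2 else 1)) i'.1 := by
    rw [← h1]; simp
  have h3 : i.1.1 + 1 ∈ List.replicate (j * (if Even i'.1 then 2 else 1)) i'.1 := by
    rw [← h1]; simp [succIdx]
  have := List.eq_of_mem_replicate h2
  have := List.eq_of_mem_replicate h3
  omega

theorem coeff_potential {n : ℕ} (k : Param n) (c : Coord n) :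
    (potential k).coeff c.1.1.1 c.1.2 = k c := by
  unfold Potential.coeff
  rw [dif_pos ⟨c.1.1.2, c.2⟩]
  change potential k (powPath c.1.1 c.1.2) = k c
  unfold potential
  rw [finsum_eq_zero_of_forall_eq_zero (fun i => if_neg (crossPath_ne i _ _)), zero_add,
    finsum_eq_single _ c (fun c' hc' => if_neg fun h => hc' (powPath_inj h)), if_pos rfl]

/-! ### The matrices `A_{ij}^d` -/

/-- The function `ε_{ij}(f) = j k_{ij}`. -/
def eps {n : ℕ} (f : Potential n) (i j : ℕ) : ℂ := j * f.coeff i j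

/-- The gluing of two square matrices along the last diagonal entry of the first one and the first
diagonal entry of the second one (which agree wherever it is used). -/
def glue {a b : ℕ} (A : Matrix (Fin (a + 1)) (Fin (a + 1)) ℂ)
    (B : Matrix (Fin (b + 1)) (Fin (b + 1)) ℂ) :
    Matrix (Fin (a + b + 1)) (Fin (a + b + 1)) ℂ :=
  Matrix.of fun r c =>
    if h : r.1 < a + 1 ∧ c.1 < a + 1 then A ⟨r, h.1⟩ ⟨c, h.2⟩
    else if a ≤ r.1 ∧ a ≤ c.1 then B ⟨r - a, by omega⟩ ⟨c - a, by omega⟩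
    else 0

/-- `A_{i,i+1}^2`. -/
def block2 {n : ℕ} (f : Potential n) (i : ℕ) : Matrix (Fin 2) (Fin 2) ℂ :=
  !![eps f i 2, 1; 1, eps f (i + 1) 2]

/-- `A_{i,i+2}^d` for `d > 2`, with rows and columns numbered from `0` to `d`. -/
def block {n : ℕ} (f : Potential n) (d i : ℕ) : Matrix (Fin (d + 1)) (Fin (d + 1)) ℂ :=
  Matrix.of fun r c =>
    if r.1 = 0 then (if c.1 = 0 then eps f i d else if c.1 + 1 = d then 1 else 0)
    else if r.1 + 1 < d then (if c.1 + 1 = r.1 ∨ c.1 = r.1 then 1 else 0)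
    else if r.1 + 1 = d then (if c.1 + 1 = r.1 ∨ c.1 = d then 1 else 0)
    else (if c.1 + 1 = d then 1 else if c.1 = d then eps f (i + 2) d else 0)

/-- `A_{i,i+l}^2`. -/
def matA2 {n : ℕ} (f : Potential n) (i : ℕ) : (l : ℕ) → Matrix (Fin (l + 1)) (Fin (l + 1)) ℂ
  | 0 => !![eps f i 2]
  | l + 1 => glue (matA2 f i l) (block2 f (i + l))

/-- `A_{i,i+2m}^d` for `d > 2`. -/
def matAd {n : ℕ} (f : Potential n) (d i : ℕ) :
    (m : ℕ) → Matrix (Fin (d * m + 1)) (Fin (d * m + 1)) ℂ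
  | 0 => !![eps f i d]
  | m + 1 => glue (matAd f d i m) (block f d (i + 2 * m))

/-- The matrix `A_{ij}^d(f)`, together with its size, for `1 ≤ i ≤ j ≤ 2n - 1` and `d ≥ 2`, with
`d = 2` if `j - i` is odd. -/
def matA {n : ℕ} (f : Potential n) (d i j : ℕ) : Σ N : ℕ, Matrix (Fin N) (Fin N) ℂ :=
  if d = 2 then ⟨_, matA2 f i (j - i)⟩ else ⟨_, matAd f d i ((j - i) / 2)⟩

/-! ### Generalised GV invariants -/

open MvPowerSeries (X)

/-- The ring `ℂ⟦x, y⟧`, with `x = X 0` and `y = X 1`. -/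
abbrev Cxy : Type := MvPowerSeries (Fin 2) ℂ

/-- The power series `∑_{j ≥ 2} j k_{ij} T ^ (j - 1)`. -/
noncomputable def phi {n : ℕ} (f : Potential n) (i : ℕ) : PowerSeries ℂ :=
  PowerSeries.mk fun m => ((m + 1 : ℕ) : ℂ) * f.coeff i (m + 1)

/-- `g_e, g_{e+1}, g_{e+2}, …`, starting with `g_e = y` and `g_{e+1} = x`. -/
noncomputable def gUp {n : ℕ} (f : Potential n) (e : ℕ) : ℕ → Cxy
  | 0 => X 1
  | 1 => X 0
  | m + 2 => - gUp f e m - PowerSeries.subst (gUp f e (m + 1)) (phi f (e + m + 1))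

/-- `g_{e+1}, g_e, g_{e-1}, …`, starting with `g_{e+1} = x` and `g_e = y`. -/
noncomputable def gDown {n : ℕ} (f : Potential n) (e : ℕ) : ℕ → Cxy
  | 0 => X 0
  | 1 => X 1
  | m + 2 => - gDown f e m - PowerSeries.subst (gDown f e (m + 1)) (phi f (e - m))

/-- The solution `g_0, …, g_{2n}` of the system
`g_{i-1} + ∑_{j ≥ 2} j k_{ij} g_i ^ (j - 1) + g_{i+1} = 0`, `1 ≤ i ≤ 2n - 1`,
with `g_e = y` and `g_{e+1} = x`, for the coefficients `k_{ij}` of `f`. -/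
noncomputable def g {n : ℕ} (f : Potential n) (e t : ℕ) : Cxy :=
  if e ≤ t then gUp f e (t - e) else gDown f e (e + 1 - t)

/-- The generalised GV invariant `N_{ij}(f) = dim_ℂ ℂ⟦x, y⟧ / (g_{2i-2}, g_{2j})`, computed from the
solution `g_0, …, g_{2n}` with `g_e = y` and `g_{e+1} = x`. -/
noncomputable def genGV {n : ℕ} (f : Potential n) (e i j : ℕ) : ℕ∞ :=
  Cardinal.toENat (Module.rank ℂ (Cxy ⧸ Ideal.span {g f e (2 * i - 2), g f e (2 * j)}))

/-! The sequence `g` solves the system, and its members lie in the ideal `(x, y)`. -/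

theorem phi_coeff_zero {n : ℕ} (f : Potential n) (i : ℕ) :
    PowerSeries.constantCoeff (phi f i) = 0 := by
  simp [phi, Potential.coeff]

theorem constantCoeff_subst_phi {n : ℕ} (f : Potential n) (i : ℕ) {h : Cxy}
    (hh : MvPowerSeries.constantCoeff h = 0) :
    MvPowerSeries.constantCoeff (PowerSeries.subst h (phi f i)) = 0 :=
  PowerSeries.constantCoeff_subst_eq_zero hh _ (phi_coeff_zero f i)

theorem constantCoeff_gUp {n : ℕ} (f : Potential n) (e : ℕ) :
    ∀ m, MvPowerSeries.constantCoeff (gUp f e m) = 0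
  | 0 => by simp [gUp]
  | 1 => by simp [gUp]
  | m + 2 => by
    simp [gUp, constantCoeff_gUp f e m, constantCoeff_subst_phi f _ (constantCoeff_gUp f e (m + 1))]

theorem constantCoeff_gDown {n : ℕ} (f : Potential n) (e : ℕ) :
    ∀ m, MvPowerSeries.constantCoeff (gDown f e m) = 0
  | 0 => by simp [gDown]
  | 1 => by simp [gDown]
  | m + 2 => by
    simp [gDown, constantCoeff_gDown f e m,
      constantCoeff_subst_phi f _ (constantCoeff_gDown f e (m + 1))]

theorem constantCoeff_g {n : ℕ} (f : Potential n) (e t : ℕ) :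
    MvPowerSeries.constantCoeff (g f e t) = 0 := by
  unfold g
  split_ifs
  · exact constantCoeff_gUp f e _
  · exact constantCoeff_gDown f e _

theorem g_self {n : ℕ} (f : Potential n) (e : ℕ) : g f e e = X 1 := by simp [g, gUp]

theorem g_self_succ {n : ℕ} (f : Potential n) (e : ℕ) : g f e (e + 1) = X 0 := by simp [g, gUp]

theorem g_system {n : ℕ} (f : Potential n) (e i : ℕ) (hi : 1 ≤ i) :
    g f e (i - 1) + PowerSeries.subst (g f e i) (phi f i) + g f e (i + 1) = 0 := by
  obtain ⟨i, rfl⟩ : ∃ j, i = j + 1 := ⟨i - 1, by omega⟩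
  rw [Nat.add_sub_cancel]
  have hz : ∀ t, t ≤ e + 1 → g f e t = gDown f e (e + 1 - t) := by
    intro t ht
    unfold g
    split_ifs with h
    · rcases Nat.lt_or_ge e t with h' | h'
      · obtain rfl : t = e + 1 := by omega
        simp [gUp, gDown]
      · obtain rfl : t = e := by omega
        simp [gUp, gDown]
    · rfl
  rcases Nat.lt_or_ge i e with h | h
  · obtain ⟨m, rfl⟩ : ∃ m, e = i + 1 + m := ⟨e - (i + 1), by omega⟩
    rw [hz _ (by omega), hz _ (by omega), hz _ (by omega)]
    rw [show i + 1 + m + 1 - i = m + 2 by omega, show i + 1 + m + 1 - (i + 1) = m + 1 by omega,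
      show i + 1 + m + 1 - (i + 1 + 1) = m by omega, gDown, show i + 1 + m - m = i + 1 by omega]
    ring
  · obtain ⟨m, rfl⟩ : ∃ m, i = e + m := ⟨i - e, by omega⟩
    unfold g
    rw [if_pos (by omega), if_pos (by omega), if_pos (by omega)]
    rw [show e + m - e = m by omega, show e + m + 1 - e = m + 1 by omega,
      show e + m + 1 + 1 - e = m + 2 by omega, gUp]
    ring

/-! ### The families attached to a tuple `p` -/

/-- `d_{ij}(p)`: it is `2` if `j - i` is odd, and `min (p_i, p_{i+2}, …, p_j)` if it is even. -/
noncomputable def dMin (p : ℕ → ℕ∞) (i j : ℕ) : ℕ∞ :=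
  if Odd (j - i) then 2 else (Finset.range ((j - i) / 2 + 1)).inf fun m => p (i + 2 * m)

/-- `M_p`: the tuples `k` with `k_{ij} = 0` whenever `j < p_i`. -/
def paramSpace (n : ℕ) (p : ℕ → ℕ∞) : Set (Param n) :=
  {k | ∀ c : Coord n, (c.1.2 : ℕ∞) < p c.1.1.1 → k c = 0}

/-- The indices of the coordinates `κ_{ij}` of `M_p`: those with `p_i ≤ j`. -/
abbrev CoordP (n : ℕ) (p : ℕ → ℕ∞) : Type := {c : Coord n // p c.1.1.1 ≤ (c.1.2 : ℕ∞)}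

/-- The common zero locus in `M_p` of a set of polynomials in the coordinates of `M_p`. -/
def zeroLocus {n : ℕ} {p : ℕ → ℕ∞} (S : Set (MvPolynomial (CoordP n p) ℂ)) : Set (Param n) :=
  {k | k ∈ paramSpace n p ∧ ∀ P ∈ S, MvPolynomial.eval (fun c => k c.1) P = 0}

end TypeA

/-! The invariant does not depend on `e`. The system determines every $g_j$ from two consecutive
terms, so passing from the normalisation at $a$ to the one at $e$ is an automorphism of $\mathbb
C[[x,y]]$, which carries one ideal $(g_{2s-2},g_{2t})$ to the other. With $e=2s-2$ the first
generator is $y$. The quotient becomes $\mathbb C[[X]]/(h)$, where $h$ is $g_{2t}$ modulo $y$, and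
its dimension is the order of $h$. This $h$ is `reducedGV`: the term of index $2(t-s+1)$ in the same
recursion started at $0, X$ (`genGV_eq_order`).

Let $M_i$ be the locus where the first $d+i-2$ coefficients of $h$ vanish. The order is then $d+i-2$
on $M_i\setminus M_{i+1}$. Each coefficient of $h$ is a polynomial in the parameters
(`coeff_reduced_mem`). Terms of even index are modified only by the series $\varphi_i$ attached to
loops, all divisible by $X^{d-1}$, so $M_1=\mathsf M_{\mathbf p}$ (`X_pow_dvd_reduced`). If all
these $\varphi_i$ vanish, so does $h$; this is the case $d=\infty$. Strictness comes from parameters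
with a single non-zero coordinate, for which $h$ is a monomial (`reduced_of_single`).

The coefficient of $X^{d-1}$ in $h$ obeys a linear recursion. Eliminating variables in the matrix
$A^d$ row by row runs the same recursion, so the determinant vanishes exactly when this coefficient
does (`det_matA_eq_zero_iff`). -/

namespace TypeA

open MvPowerSeries (X)

section Invariant

/-! ### Colength of a principal ideal of `K⟦X⟧` -/

section Order

variable {K : Type*} [Field K]

/-- The first `N` coefficients of a power series. -/
noncomputable def firstCoeffs (K : Type*) [Field K] (N : ℕ) : PowerSeries K →ₗ[K] (Fin N → K) :=
  LinearMap.pi fun i => PowerSeries.coeff i.1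

theorem firstCoeffs_surjective (N : ℕ) : Function.Surjective (firstCoeffs K N) := by
  intro v
  refine ⟨PowerSeries.mk fun m => if h : m < N then v ⟨m, h⟩ else 0, ?_⟩
  ext i
  simp [firstCoeffs]

theorem ker_firstCoeffs (N : ℕ) : LinearMap.ker (firstCoeffs K N) =
    (Ideal.span {(PowerSeries.X : PowerSeries K) ^ N}).restrictScalars K := by
  ext f
  rw [LinearMap.mem_ker, Submodule.restrictScalars_mem, Ideal.mem_span_singleton,
    PowerSeries.X_pow_dvd_iff, funext_iff]
  exact ⟨fun h m hm => h ⟨m, hm⟩, fun h i => h i.1 i.2⟩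

theorem rank_quotient_X_pow (N : ℕ) :
    Module.rank K (PowerSeries K ⧸ Ideal.span {(PowerSeries.X : PowerSeries K) ^ N}) = N := by
  have e := (firstCoeffs K N).quotKerEquivOfSurjective (firstCoeffs_surjective N)
  rw [ker_firstCoeffs] at e
  have e' : (PowerSeries K ⧸ Ideal.span {(PowerSeries.X : PowerSeries K) ^ N}) ≃ₗ[K]
      (Fin N → K) := (Submodule.Quotient.restrictScalarsEquiv K _).symm.trans e
  rw [e'.rank_eq, rank_fin_fun]

/-- A non-zero series is a unit times $X$ to its order. For zero, the whole ring surjects onto $K^N$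
for every $N$, so its rank is infinite, matching the order $\top$. -/
theorem toENat_rank_quotient_span_singleton (h : PowerSeries K) :
    Cardinal.toENat (Module.rank K (PowerSeries K ⧸ Ideal.span {h})) = h.order := by
  by_cases hh : h = 0
  · subst hh
    rw [PowerSeries.order_zero, Cardinal.toENat_eq_top]
    have e : (PowerSeries K ⧸ Ideal.span {(0 : PowerSeries K)}) ≃ₗ[K] PowerSeries K := by
      rw [Ideal.span_singleton_zero]
      exact (AlgEquiv.quotientBot K (PowerSeries K)).toLinearEquiv
    rw [e.rank_eq, Cardinal.aleph0_le]
    intro N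
    have := LinearMap.rank_le_of_surjective (firstCoeffs K N) (firstCoeffs_surjective N)
    rwa [rank_fin_fun] at this
  · have hspan : Ideal.span {h} = Ideal.span {(PowerSeries.X : PowerSeries K) ^ h.order.toNat} := by
      rw [Ideal.span_singleton_eq_span_singleton]
      refine ⟨(PowerSeries.Unit_of_divided_by_X_pow_order h)⁻¹, ?_⟩
      rw [Units.mul_inv_eq_iff_eq_mul, PowerSeries.Unit_of_divided_by_X_pow_order_nonzero hh]
      exact PowerSeries.X_pow_order_mul_divXPowOrder.symm
    rw [hspan, rank_quotient_X_pow, Cardinal.toENat_nat, PowerSeries.coe_toNat_order hh]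

end Order

/-! ### Substitutions into `ℂ⟦x, y⟧` -/

theorem subst_powerSeries_subst {τ : Type*} {a : Fin 2 → MvPowerSeries τ ℂ}
    (ha : MvPowerSeries.HasSubst a) {h : Cxy} (hh : MvPowerSeries.constantCoeff h = 0)
    (φ : PowerSeries ℂ) :
    MvPowerSeries.subst a (PowerSeries.subst h φ) =
      PowerSeries.subst (MvPowerSeries.subst a h) φ := by
  rw [PowerSeries.subst_def, PowerSeries.subst_def,
    MvPowerSeries.subst_comp_subst_apply (PowerSeries.HasSubst.of_constantCoeff_zero hh).const ha]

/-- Two solutions of the system that agree in degrees `a` and `a + 1` are equal. -/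
theorem system_unique {R : Type*} [CommRing R] {F : ℕ → R → R} {u v : ℕ → R}
    (hu : ∀ i, u i + F (i + 1) (u (i + 1)) + u (i + 2) = 0)
    (hv : ∀ i, v i + F (i + 1) (v (i + 1)) + v (i + 2) = 0) (a : ℕ)
    (h0 : u a = v a) (h1 : u (a + 1) = v (a + 1)) (j : ℕ) : u j = v j := by
  have up : ∀ m, u (a + m) = v (a + m) ∧ u (a + m + 1) = v (a + m + 1) := by
    intro m
    induction m with
    | zero => exact ⟨h0, h1⟩
    | succ m ih =>
      refine ⟨ih.2, ?_⟩
      have e1 := hu (a + m)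
      have e2 := hv (a + m)
      rw [ih.1, ih.2] at e1
      exact add_left_cancel (e1.trans e2.symm)
  -- The system is symmetric in $i-1$ and $i+1$, so it can also be solved downwards.
  have down : ∀ m, m ≤ a → u (a - m) = v (a - m) ∧ u (a - m + 1) = v (a - m + 1) := by
    intro m
    induction m with
    | zero => exact fun _ => ⟨h0, h1⟩
    | succ m ih =>
      intro hm
      obtain ⟨i0, i1⟩ := ih (by omega)
      have e1 := hu (a - (m + 1))
      have e2 := hv (a - (m + 1))
      rw [show a - (m + 1) + 1 = a - m by omega,
        show a - (m + 1) + 2 = a - m + 1 by omega] at e1 e2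
      rw [i0, i1] at e1
      refine ⟨add_right_cancel (add_right_cancel (e1.trans e2.symm)), ?_⟩
      rw [show a - (m + 1) + 1 = a - m by omega]
      exact i0
  rcases Nat.le_total a j with h | h
  · simpa [Nat.add_sub_cancel' h] using (up (j - a)).1
  · simpa [Nat.sub_sub_self h] using (down (a - j) (Nat.sub_le _ _)).1

/-! ### Independence of the normalisation index -/

variable {n : ℕ} (f : Potential n)

theorem g_system_succ (e i : ℕ) :
    g f e i + PowerSeries.subst (g f e (i + 1)) (phi f (i + 1)) + g f e (i + 2) = 0 :=
  g_system f e (i + 1) (Nat.le_add_left _ _)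

/-- The images of `x`, `y` under the change of coordinates from the solution normalised at `a` to
the one normalised at `e`. -/
noncomputable def gPair (e a : ℕ) : Fin 2 → Cxy := ![g f e (a + 1), g f e a]

theorem hasSubst_gPair (e a : ℕ) : MvPowerSeries.HasSubst (gPair f e a) :=
  MvPowerSeries.hasSubst_of_constantCoeff_zero fun i => by
    fin_cases i <;> exact constantCoeff_g f e _

/-- Substitution commutes with the recursion, so both sides solve one system; they agree at $a$ and
$a+1$ by the choice of `gPair`, and uniqueness applies. -/
theorem subst_gPair_g (e a j : ℕ) : MvPowerSeries.subst (gPair f e a) (g f a j) = g f e j := by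
  have ha := hasSubst_gPair f e a
  refine system_unique (F := fun i h => PowerSeries.subst h (phi f i))
    (u := fun j => MvPowerSeries.subst (gPair f e a) (g f a j)) (v := g f e) (fun i => ?_)
    (g_system_succ f e) a ?_ ?_ j
  · have h := congrArg (MvPowerSeries.substAlgHom ha) (g_system_succ f a i)
    rw [map_add, map_add, map_zero] at h
    simp only [MvPowerSeries.substAlgHom_apply] at h
    rwa [subst_powerSeries_subst ha (constantCoeff_g f a _)] at h
  · simp only [g_self]
    rw [MvPowerSeries.subst_X ha]; rfl
  · simp only [g_self_succ]
    rw [MvPowerSeries.subst_X ha]; rfl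

theorem subst_gPair_subst_gPair (e a : ℕ) (h : Cxy) :
    MvPowerSeries.subst (gPair f e a) (MvPowerSeries.subst (gPair f a e) h) = h := by
  rw [MvPowerSeries.subst_comp_subst_apply (hasSubst_gPair f a e) (hasSubst_gPair f e a)]
  have : (fun i => MvPowerSeries.subst (gPair f e a) (gPair f a e i)) = MvPowerSeries.X := by
    funext i
    fin_cases i
    · exact (subst_gPair_g f e a (e + 1)).trans (g_self_succ f e)
    · exact (subst_gPair_g f e a e).trans (g_self f e)
  rw [this, MvPowerSeries.subst_self, id]

/-- The automorphism of `ℂ⟦x, y⟧` taking the solution normalised at `a` to the one normalised at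
`e`. -/
noncomputable def gEquiv (e a : ℕ) : Cxy ≃ₐ[ℂ] Cxy :=
  AlgEquiv.ofAlgHom (MvPowerSeries.substAlgHom (hasSubst_gPair f e a))
    (MvPowerSeries.substAlgHom (hasSubst_gPair f a e))
    (AlgHom.ext fun h => by
      simpa [MvPowerSeries.substAlgHom_apply] using subst_gPair_subst_gPair f e a h)
    (AlgHom.ext fun h => by
      simpa [MvPowerSeries.substAlgHom_apply] using subst_gPair_subst_gPair f a e h)

theorem gEquiv_g (e a j : ℕ) : gEquiv f e a (g f a j) = g f e j := by
  change MvPowerSeries.substAlgHom (hasSubst_gPair f e a) (g f a j) = _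
  rw [MvPowerSeries.substAlgHom_apply, subst_gPair_g]

theorem genGV_eq_genGV (e a s t : ℕ) : genGV f e s t = genGV f a s t := by
  unfold genGV
  congr 1
  refine (LinearEquiv.rank_eq (Ideal.quotientEquivAlg _ _ (gEquiv f e a) ?_).toLinearEquiv).symm
  rw [Ideal.map_span, Set.image_pair]
  change _ = Ideal.span {gEquiv f e a _, gEquiv f e a _}
  rw [gEquiv_g, gEquiv_g]

/-! ### Reduction modulo `y` -/

/-- The substitution `x ↦ X`, `y ↦ 0`. -/
noncomputable def axisPair : Fin 2 → PowerSeries ℂ := ![PowerSeries.X, 0]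

theorem hasSubst_axisPair : MvPowerSeries.HasSubst axisPair :=
  MvPowerSeries.hasSubst_of_constantCoeff_zero fun i => by
    fin_cases i
    · exact PowerSeries.constantCoeff_X
    · exact map_zero _

/-- Reduction modulo `y`. -/
noncomputable def modY : Cxy →ₐ[ℂ] PowerSeries ℂ := MvPowerSeries.substAlgHom hasSubst_axisPair

theorem modY_X_zero : modY (X 0) = PowerSeries.X := MvPowerSeries.substAlgHom_X _ _

theorem modY_X_one : modY (X 1) = 0 := MvPowerSeries.substAlgHom_X _ _

theorem modY_subst {h : Cxy} (hh : MvPowerSeries.constantCoeff h = 0) (φ : PowerSeries ℂ) :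
    modY (PowerSeries.subst h φ) = PowerSeries.subst (modY h) φ := by
  simp only [modY, MvPowerSeries.substAlgHom_apply]
  exact subst_powerSeries_subst hasSubst_axisPair hh φ

theorem modY_subst_X_zero (φ : PowerSeries ℂ) :
    modY (PowerSeries.subst (X 0 : Cxy) φ) = φ := by
  rw [modY_subst (MvPowerSeries.constantCoeff_X 0), modY_X_zero, PowerSeries.X_subst]

theorem coeff_modY (h : Cxy) (m : ℕ) :
    PowerSeries.coeff m (modY h) = MvPowerSeries.coeff (Finsupp.single 0 m) h := by
  rw [modY, MvPowerSeries.substAlgHom_apply, PowerSeries.coeff,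
    MvPowerSeries.coeff_subst hasSubst_axisPair, finsum_eq_single _ (Finsupp.single 0 m)]
  · rw [Finsupp.prod_single_index (by simp)]
    change _ • PowerSeries.coeff m (PowerSeries.X ^ m) = _
    simp
  · intro d hd
    rw [Finsupp.prod_fintype _ _ (by simp), Fin.prod_univ_two]
    change _ • PowerSeries.coeff m (PowerSeries.X ^ d 0 * 0 ^ d 1) = _
    by_cases h1 : d 1 = 0
    · have h0 : d 0 ≠ m := by
        rintro rfl
        apply hd
        ext i
        fin_cases i
        · simp
        · simpa using h1
      simp [h1, PowerSeries.coeff_X_pow, h0.symm]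
    · simp [h1]

theorem modY_eq_zero_iff (h : Cxy) : modY h = 0 ↔ X 1 ∣ h := by
  rw [MvPowerSeries.X_dvd_iff, PowerSeries.ext_iff]
  simp only [coeff_modY, map_zero]
  refine ⟨fun H m hm => ?_, fun H m => H _ (by simp)⟩
  have : m = Finsupp.single 0 (m 0) := by
    ext i
    fin_cases i
    · simp
    · simpa using hm
  rw [this]
  exact H _

/-- The ideal $(y,G)$ is the kernel of reduction modulo $y$ followed by the quotient by the
reduction of $G$. -/
theorem toENat_rank_quotient_X_one (G : Cxy) :
    Cardinal.toENat (Module.rank ℂ (Cxy ⧸ Ideal.span {X 1, G})) = (modY G).order := by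
  rw [← toENat_rank_quotient_span_singleton]
  congr 1
  have hs : Function.Surjective ((Ideal.Quotient.mkₐ ℂ (Ideal.span {modY G})).comp modY) :=
    (Ideal.Quotient.mkₐ_surjective ℂ (Ideal.span {modY G})).comp fun φ => ⟨_, modY_subst_X_zero φ⟩
  have hk : Ideal.span {X 1, G} =
      RingHom.ker ((Ideal.Quotient.mkₐ ℂ (Ideal.span {modY G})).comp modY) := by
    apply le_antisymm
    · rw [Ideal.span_le, Set.pair_subset_iff]
      constructor
      · simp [RingHom.mem_ker, modY_X_one]
      · simp [RingHom.mem_ker]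
    · intro h hh
      rw [RingHom.mem_ker, AlgHom.comp_apply, Ideal.Quotient.mkₐ_eq_mk,
        Ideal.Quotient.eq_zero_iff_mem, Ideal.mem_span_singleton] at hh
      obtain ⟨q, hq⟩ := hh
      -- The series $q$, read as a series in $x$ alone, lifts the quotient; what remains reduces to
      -- zero and is therefore divisible by $y$.
      have h1 : X 1 ∣ h - G * PowerSeries.subst (X 0 : Cxy) q := by
        rw [← modY_eq_zero_iff, map_sub, map_mul, modY_subst_X_zero, hq, sub_self]
      obtain ⟨r, hr⟩ := h1
      rw [Ideal.mem_span_pair]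
      exact ⟨r, PowerSeries.subst (X 0 : Cxy) q, by linear_combination -hr⟩
  rw [hk]
  exact (Ideal.quotientKerAlgEquivOfSurjective hs).toLinearEquiv.rank_eq

/-! ### The reduced system -/

/-- The solution of the system with coefficients `φ_1, φ_2, …` starting with `0` and `X`. -/
noncomputable def reduced (φ : ℕ → PowerSeries ℂ) : ℕ → PowerSeries ℂ
  | 0 => 0
  | 1 => PowerSeries.X
  | m + 2 => - reduced φ m - PowerSeries.subst (reduced φ (m + 1)) (φ (m + 1))

theorem modY_gUp (a : ℕ) :
    ∀ m, modY (gUp f a m) = reduced (fun i => phi f (a + i)) m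
  | 0 => modY_X_one
  | 1 => modY_X_zero
  | m + 2 => by
    rw [gUp, map_sub, map_neg, modY_subst (constantCoeff_gUp f a (m + 1)), modY_gUp a m,
      modY_gUp a (m + 1), reduced]
    rfl

theorem genGV_eq_order (e : ℕ) {s t : ℕ} (hs : 1 ≤ s) (hst : s ≤ t) :
    genGV f e s t =
      (reduced (fun i => phi f (2 * s - 2 + i)) (2 * (t - s) + 2)).order := by
  rw [genGV_eq_genGV f e (2 * s - 2), genGV, g_self, toENat_rank_quotient_X_one, g,
    if_pos (by omega), modY_gUp]
  congr 2
  omega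

theorem constantCoeff_reduced {φ : ℕ → PowerSeries ℂ}
    (hφ : ∀ i, PowerSeries.constantCoeff (φ i) = 0) :
    ∀ m, PowerSeries.constantCoeff (reduced φ m) = 0
  | 0 => by simp [reduced]
  | 1 => by simp [reduced]
  | m + 2 => by
    have := PowerSeries.constantCoeff_subst_eq_zero
      (constantCoeff_reduced hφ (m + 1)) _ (hφ (m + 1))
    rw [reduced, map_sub, map_neg, constantCoeff_reduced hφ m, neg_zero, zero_sub, neg_eq_zero]
    exact this

end Invariant

section Coefficients

/-! ### Coefficients of substitutions -/

theorem subst_eq_pow_mul_subst {h φ : PowerSeries ℂ} (hh : PowerSeries.constantCoeff h = 0) {D : ℕ}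
    (hφ : PowerSeries.X ^ D ∣ φ) : ∃ q, PowerSeries.subst h φ = h ^ D * q := by
  have hs : PowerSeries.HasSubst h := PowerSeries.HasSubst.of_constantCoeff_zero' hh
  obtain ⟨q, rfl⟩ := hφ
  refine ⟨PowerSeries.subst h q, ?_⟩
  rw [PowerSeries.subst_mul hs, PowerSeries.subst_pow hs, PowerSeries.subst_X hs]

theorem X_pow_dvd_subst {h φ : PowerSeries ℂ} (hh : PowerSeries.constantCoeff h = 0) {D : ℕ}
    (hφ : PowerSeries.X ^ D ∣ φ) : PowerSeries.X ^ D ∣ PowerSeries.subst h φ := by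
  obtain ⟨q, hq⟩ := subst_eq_pow_mul_subst hh hφ
  rw [hq]
  exact Dvd.dvd.mul_right (pow_dvd_pow_of_dvd (PowerSeries.X_dvd_iff.2 hh) D) q

theorem coeff_subst_eq_sum {h : PowerSeries ℂ} (hh : PowerSeries.constantCoeff h = 0)
    (φ : PowerSeries ℂ) (N : ℕ) : PowerSeries.coeff N (PowerSeries.subst h φ) =
      ∑ j ∈ Finset.range (N + 1), PowerSeries.coeff j φ * PowerSeries.coeff N (h ^ j) := by
  rw [PowerSeries.coeff_subst' (PowerSeries.HasSubst.of_constantCoeff_zero' hh),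
    finsum_eq_sum_of_support_subset]
  · rfl
  · intro j hj
    by_contra hN
    rw [Finset.mem_coe, Finset.mem_range, not_lt] at hN
    apply hj
    have := PowerSeries.X_pow_dvd_iff.1 (pow_dvd_pow_of_dvd (PowerSeries.X_dvd_iff.2 hh) j) N hN
    simp [this]

theorem coeff_pow_self {h : PowerSeries ℂ} (hh : PowerSeries.constantCoeff h = 0) (D : ℕ) :
    PowerSeries.coeff D (h ^ D) = PowerSeries.coeff 1 h ^ D := by
  obtain ⟨q, rfl⟩ := PowerSeries.X_dvd_iff.2 hh
  rw [mul_pow, show PowerSeries.coeff D (PowerSeries.X ^ D * q ^ D) = PowerSeries.coeff 0 (q ^ D)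
    by simpa using PowerSeries.coeff_X_pow_mul (q ^ D) D 0]
  have h1 : PowerSeries.coeff 1 (PowerSeries.X * q) = PowerSeries.coeff 0 q :=
    PowerSeries.coeff_succ_X_mul 0 q
  rw [h1]
  simp

theorem coeff_subst_of_X_pow_dvd {h φ : PowerSeries ℂ} (hh : PowerSeries.constantCoeff h = 0)
    {D : ℕ} (hφ : PowerSeries.X ^ D ∣ φ) : PowerSeries.coeff D (PowerSeries.subst h φ) =
      PowerSeries.coeff D φ * PowerSeries.coeff 1 h ^ D := by
  rw [coeff_subst_eq_sum hh, Finset.sum_range_succ, Finset.sum_eq_zero, zero_add,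
    coeff_pow_self hh]
  intro j hj
  rw [PowerSeries.X_pow_dvd_iff.1 hφ j (Finset.mem_range.1 hj), zero_mul]

/-! ### Leading coefficients of the reduced system -/

/-- Linear parts satisfy a three-term recursion involving all indices, even ones included; this is
the recursion behind the tridiagonal matrix for $d=2$. -/
theorem coeff_one_reduced {φ : ℕ → PowerSeries ℂ}
    (hφ : ∀ i, PowerSeries.constantCoeff (φ i) = 0) (m : ℕ) : PowerSeries.coeff 1 (reduced φ (m + 2)) =
    -PowerSeries.coeff 1 (reduced φ m) -
      PowerSeries.coeff 1 (φ (m + 1)) * PowerSeries.coeff 1 (reduced φ (m + 1)) := by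
  have h1 : (PowerSeries.X : PowerSeries ℂ) ^ 1 ∣ φ (m + 1) := by
    rw [pow_one]
    exact PowerSeries.X_dvd_iff.2 (hφ _)
  rw [reduced, map_sub, map_neg, coeff_subst_of_X_pow_dvd (constantCoeff_reduced hφ _) h1, pow_one]

/-- Between consecutive terms of even index only a $\varphi$ of odd index is substituted into, which
is why $d$ is a minimum over loops only. -/
theorem X_pow_dvd_reduced {φ : ℕ → PowerSeries ℂ} (hφ : ∀ i, PowerSeries.constantCoeff (φ i) = 0)
    {D l : ℕ} (hD : ∀ q < l, PowerSeries.X ^ D ∣ φ (2 * q + 1)) :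
    ∀ q ≤ l, PowerSeries.X ^ D ∣ reduced φ (2 * q) := by
  intro q
  induction q with
  | zero => exact fun _ => dvd_zero _
  | succ q ih =>
    intro hq
    rw [show 2 * (q + 1) = 2 * q + 2 by ring, reduced]
    exact dvd_sub (dvd_neg.2 (ih (by omega)))
      (X_pow_dvd_subst (constantCoeff_reduced hφ _) (hD q (by omega)))

/-- For $D\ge2$ the terms of even index have no linear part, so the $\varphi$ of even index
contribute nothing and each step of two only flips the sign. -/
theorem coeff_one_reduced_odd {φ : ℕ → PowerSeries ℂ}
    (hφ : ∀ i, PowerSeries.constantCoeff (φ i) = 0)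
    {D l : ℕ} (hD2 : 2 ≤ D) (hD : ∀ q < l, PowerSeries.X ^ D ∣ φ (2 * q + 1)) :
    ∀ q ≤ l, PowerSeries.coeff 1 (reduced φ (2 * q + 1)) = (-1) ^ q := by
  intro q
  induction q with
  | zero => simp [reduced]
  | succ q ih =>
    intro hq
    have h0 : PowerSeries.coeff 1 (reduced φ (2 * q + 1 + 1)) = 0 :=
      PowerSeries.X_pow_dvd_iff.1 (X_pow_dvd_reduced hφ hD (q + 1) hq) 1 (by omega)
    rw [show 2 * (q + 1) + 1 = 2 * q + 1 + 2 by ring, coeff_one_reduced hφ, ih (by omega), h0]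
    ring

theorem coeff_reduced_even {φ : ℕ → PowerSeries ℂ}
    (hφ : ∀ i, PowerSeries.constantCoeff (φ i) = 0)
    {D l : ℕ} (hD2 : 2 ≤ D) (hD : ∀ q < l, PowerSeries.X ^ D ∣ φ (2 * q + 1)) {q : ℕ} (hq : q < l) :
    PowerSeries.coeff D (reduced φ (2 * (q + 1))) =
      -PowerSeries.coeff D (reduced φ (2 * q)) -
        PowerSeries.coeff D (φ (2 * q + 1)) * ((-1) ^ D) ^ q := by
  rw [show 2 * (q + 1) = 2 * q + 2 by ring, reduced, map_sub, map_neg,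
    coeff_subst_of_X_pow_dvd (constantCoeff_reduced hφ _) (hD q hq),
    coeff_one_reduced_odd hφ hD2 hD q hq.le, ← pow_mul, ← pow_mul, mul_comm q]

theorem reduced_add_two_of_eq_zero {φ : ℕ → PowerSeries ℂ}
    (hφ : ∀ i, PowerSeries.constantCoeff (φ i) = 0) {m : ℕ} (h : φ (m + 1) = 0) :
    reduced φ (m + 2) = -reduced φ m := by
  rw [reduced, h, ← PowerSeries.coe_substAlgHom
    (PowerSeries.HasSubst.of_constantCoeff_zero' (constantCoeff_reduced hφ (m + 1))), map_zero,
    sub_zero]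

theorem reduced_even_eq_zero {φ : ℕ → PowerSeries ℂ}
    (hφ : ∀ i, PowerSeries.constantCoeff (φ i) = 0) {l : ℕ} (h : ∀ q < l, φ (2 * q + 1) = 0) :
    ∀ q ≤ l, reduced φ (2 * q) = 0 := by
  intro q
  induction q with
  | zero => exact fun _ => rfl
  | succ q ih =>
    intro hq
    rw [show 2 * (q + 1) = 2 * q + 2 by ring, reduced_add_two_of_eq_zero hφ (h q (by omega)),
      ih (by omega), neg_zero]

/-- If only one of the coefficients is non-zero, and it is a monomial, then so are the later members
of even index of the solution. -/
theorem reduced_of_single {φ : ℕ → PowerSeries ℂ} {r N : ℕ} {c : ℂ} (hc : c ≠ 0) (hN : N ≠ 0)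
    (h0 : ∀ i, i ≠ 2 * r + 1 → φ i = 0) (hr : φ (2 * r + 1) = c • PowerSeries.X ^ N) {q : ℕ}
    (hq : r < q) : ∃ u : ℂ, u ≠ 0 ∧ reduced φ (2 * q) = u • PowerSeries.X ^ N := by
  have hφ : ∀ i, PowerSeries.constantCoeff (φ i) = 0 := by
    intro i
    by_cases hi : i = 2 * r + 1
    · rw [hi, hr, ← PowerSeries.coeff_zero_eq_constantCoeff_apply, map_smul,
        PowerSeries.coeff_X_pow, if_neg hN.symm, smul_zero]
    · rw [h0 i hi, map_zero]
  have hodd : ∀ q, reduced φ (2 * q + 1) = (-1) ^ q * PowerSeries.X := by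
    intro q
    induction q with
    | zero => simp [reduced]
    | succ q ih =>
      rw [show 2 * (q + 1) + 1 = 2 * q + 1 + 2 by ring,
        reduced_add_two_of_eq_zero hφ (h0 _ (by omega)), ih]
      ring
  have heven : ∀ q ≤ r, reduced φ (2 * q) = 0 :=
    reduced_even_eq_zero hφ fun q hq => h0 _ (by omega)
  induction q, hq using Nat.le_induction with
  | base =>
    have hs : PowerSeries.HasSubst (reduced φ (2 * r + 1)) :=
      PowerSeries.HasSubst.of_constantCoeff_zero' (constantCoeff_reduced hφ _)
    -- The preceding term of odd index is $(-1)^rX$, and it is substituted into $cX^N$.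
    refine ⟨-(c * ((-1) ^ r) ^ N), by simp [hc], ?_⟩
    rw [Nat.succ_eq_add_one, show 2 * (r + 1) = 2 * r + 2 by ring, reduced, heven r le_rfl, hr,
      PowerSeries.subst_smul hs, PowerSeries.subst_pow hs, PowerSeries.subst_X hs, hodd, mul_pow,
      neg_zero, zero_sub, neg_smul, mul_smul, Algebra.smul_def (((-1) ^ r) ^ N : ℂ), map_pow, map_pow,
      map_neg, map_one]
  | succ q hq ih =>
    obtain ⟨u, hu, h⟩ := ih
    refine ⟨-u, neg_ne_zero.2 hu, ?_⟩
    rw [show 2 * (q + 1) = 2 * q + 2 by ring,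
      reduced_add_two_of_eq_zero hφ (h0 _ (by omega)), h, neg_smul]

/-! ### Polynomial dependence on the parameters -/

section Mem

variable {K : Type*} (A : Subring (K → ℂ))

/-- Here `A` stands for a ring of admissible functions of the parameters; it is later the ring of
polynomial functions on $\mathsf M_{\mathbf p}$. -/
theorem coeff_mul_mem {F G : K → PowerSeries ℂ}
    (hF : ∀ N, (fun k => PowerSeries.coeff N (F k)) ∈ A)
    (hG : ∀ N, (fun k => PowerSeries.coeff N (G k)) ∈ A) (N : ℕ) :
    (fun k => PowerSeries.coeff N (F k * G k)) ∈ A := by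
  have : (fun k => PowerSeries.coeff N (F k * G k)) = ∑ x ∈ Finset.HasAntidiagonal.antidiagonal N,
      (fun k => PowerSeries.coeff x.1 (F k)) * (fun k => PowerSeries.coeff x.2 (G k)) := by
    funext k
    simp [PowerSeries.coeff_mul]
  rw [this]
  exact sum_mem fun x _ => mul_mem (hF _) (hG _)

theorem coeff_pow_mem {F : K → PowerSeries ℂ}
    (hF : ∀ N, (fun k => PowerSeries.coeff N (F k)) ∈ A) (j N : ℕ) :
    (fun k => PowerSeries.coeff N (F k ^ j)) ∈ A := by
  induction j generalizing N with
  | zero =>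
    simp only [pow_zero, PowerSeries.coeff_one]
    split_ifs
    · exact one_mem A
    · exact zero_mem A
  | succ j ih =>
    simp only [pow_succ]
    exact coeff_mul_mem A ih hF N

theorem coeff_reduced_mem {φ : K → ℕ → PowerSeries ℂ}
    (hφ : ∀ k i, PowerSeries.constantCoeff (φ k i) = 0)
    (h : ∀ i N, (fun k => PowerSeries.coeff N (φ k i)) ∈ A) :
    ∀ m N, (fun k => PowerSeries.coeff N (reduced (φ k) m)) ∈ A
  | 0, N => by
    simp only [reduced, map_zero]
    exact zero_mem A
  | 1, N => by
    simp only [reduced, PowerSeries.coeff_X]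
    split_ifs
    · exact one_mem A
    · exact zero_mem A
  | m + 2, N => by
    have : (fun k => PowerSeries.coeff N (reduced (φ k) (m + 2))) =
        -(fun k => PowerSeries.coeff N (reduced (φ k) m)) - ∑ j ∈ Finset.range (N + 1),
          (fun k => PowerSeries.coeff j (φ k (m + 1))) *
            (fun k => PowerSeries.coeff N (reduced (φ k) (m + 1) ^ j)) := by
      funext k
      rw [reduced, map_sub, map_neg, coeff_subst_eq_sum (constantCoeff_reduced (hφ k) _)]
      simp
    rw [this]
    exact sub_mem (neg_mem (coeff_reduced_mem hφ h m N)) (sum_mem fun j _ =>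
      mul_mem (h _ _) (coeff_pow_mem A (coeff_reduced_mem hφ h (m + 1)) j N))

end Mem

end Coefficients

section Matrices

/-! ### Kernels of the matrices `A_{ij}^d` -/

/-- The entry in the row `r` of the product of `A` and the column `w 0, w 1, …`. -/
noncomputable def rowSum {N : ℕ} (A : Matrix (Fin N) (Fin N) ℂ) (w : ℕ → ℂ) (r : Fin N) : ℂ :=
  ∑ c, A r c * w c

/-- A criterion for the singularity of a matrix whose kernel is determined by the first coordinate
and all rows but the last one. -/
theorem det_eq_zero_iff_of_rowSum {N : ℕ} (A : Matrix (Fin (N + 1)) (Fin (N + 1)) ℂ) (κ : ℂ)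
    (h : ∀ w : ℕ → ℂ, (∀ r : Fin (N + 1), r.1 < N → rowSum A w r = 0) →
      rowSum A w (Fin.last N) = κ * w 0 ∧ (w 0 = 0 → ∀ j ≤ N, w j = 0))
    (hw : ∃ w : ℕ → ℂ, w 0 = 1 ∧ ∀ r : Fin (N + 1), r.1 < N → rowSum A w r = 0) :
    A.det = 0 ↔ κ = 0 := by
  rw [← Matrix.exists_mulVec_eq_zero_iff]
  constructor
  · rintro ⟨v, hv, hA⟩
    -- Vectors are extended by zero to sequences, so that matrices of different sizes can share one
    -- `w`.
    let w : ℕ → ℂ := fun j => if hj : j < N + 1 then v ⟨j, hj⟩ else 0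
    have hwv : ∀ c : Fin (N + 1), w c = v c := fun c => dif_pos c.2
    have hrow : ∀ r, rowSum A w r = 0 := by
      intro r
      have := congrFun hA r
      simpa [Matrix.mulVec, dotProduct, rowSum, hwv] using this
    obtain ⟨h1, h2⟩ := h w fun r _ => hrow r
    rw [hrow] at h1
    refine (mul_eq_zero.1 h1.symm).resolve_right fun h0 => hv ?_
    funext c
    rw [← hwv, h2 h0 c (Nat.lt_succ_iff.1 c.2)]
    rfl
  · rintro rfl
    obtain ⟨w, hw0, hw⟩ := hw
    refine ⟨fun c => w c, fun h0 => ?_, ?_⟩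
    · have := congrFun h0 0
      simp [hw0] at this
    · funext r
      change rowSum A w r = 0
      rcases (Nat.lt_succ_iff.1 r.2).lt_or_eq with hr | hr
      · exact hw r hr
      · obtain rfl : r = Fin.last N := Fin.ext hr
        rw [(h w hw).1, zero_mul]

/-! ### Row sums of a glued matrix -/

section Glue

variable {a b : ℕ} (A : Matrix (Fin (a + 1)) (Fin (a + 1)) ℂ)
  (B : Matrix (Fin (b + 1)) (Fin (b + 1)) ℂ) (w : ℕ → ℂ)

theorem glue_apply_left {r c : ℕ} (hr : r ≤ a) (hc : c ≤ a) :
    glue A B ⟨r, by omega⟩ ⟨c, by omega⟩ = A ⟨r, by omega⟩ ⟨c, by omega⟩ :=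
  dif_pos ⟨Nat.lt_succ_of_le hr, Nat.lt_succ_of_le hc⟩

theorem rowSum_glue (r : Fin (a + b + 1)) : rowSum (glue A B) w r =
    ∑ c : Fin a, glue A B r ⟨c, by omega⟩ * w c +
      ∑ c : Fin (b + 1), glue A B r ⟨a + c, by omega⟩ * w (a + c) :=
  Fin.sum_univ_add (a := a) (b := b + 1) fun c => glue A B r c * w c

theorem rowSum_glue_of_le {r : ℕ} (hr : r ≤ a) :
    rowSum (glue A B) w ⟨r, by omega⟩ = rowSum A w ⟨r, by omega⟩ +
      ∑ c : Fin b, glue A B ⟨r, by omega⟩ ⟨a + (c.1 + 1), by omega⟩ * w (a + (c.1 + 1)) := by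
  rw [rowSum_glue, Fin.sum_univ_succ, ← add_assoc, rowSum, Fin.sum_univ_castSucc]
  refine congrArg₂ (· + ·) (congrArg₂ (· + ·) (Finset.sum_congr rfl fun c _ => ?_) ?_) rfl
  · exact congrArg (· * w c) (glue_apply_left A B hr c.2.le)
  · exact congrArg (· * w a) (glue_apply_left A B hr le_rfl)

theorem rowSum_glue_of_lt {r : ℕ} (hr : r < a) :
    rowSum (glue A B) w ⟨r, by omega⟩ = rowSum A w ⟨r, by omega⟩ := by
  rw [rowSum_glue_of_le A B w hr.le, Finset.sum_eq_zero, add_zero]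
  intro c _
  simp [glue, show ¬ a ≤ r by omega]

/-- The shared diagonal entry is counted in the row of `A`, so the sum over the first row of `B`
omits its first column. -/
theorem rowSum_glue_mid :
    rowSum (glue A B) w ⟨a, by omega⟩ =
      rowSum A w (Fin.last a) + ∑ c : Fin b, B 0 c.succ * w (a + (c.1 + 1)) := by
  refine (rowSum_glue_of_le A B w le_rfl).trans (congrArg₂ (· + ·) rfl ?_)
  refine Finset.sum_congr rfl fun c _ => ?_
  have h : glue A B ⟨a, by omega⟩ ⟨a + (c.1 + 1), by omega⟩ = B 0 c.succ := by
    simp [glue]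
    rfl
  rw [h]

theorem rowSum_glue_of_gt {r : ℕ} (hr : r < b) :
    rowSum (glue A B) w ⟨a + (r + 1), by omega⟩ =
      ∑ c : Fin (b + 1), B ⟨r + 1, by omega⟩ c * w (a + c.1) := by
  rw [rowSum_glue, Finset.sum_eq_zero (s := Finset.univ (α := Fin a)), zero_add]
  · refine Finset.sum_congr rfl fun c _ => ?_
    simp [glue]
  · intro c _
    simp [glue, show ¬ a ≤ c.1 by omega]

end Glue

variable {n : ℕ} (f : Potential n)

/-! ### The tridiagonal case $d=2$ -/

section Two

theorem rowSum_matA2_succ_mid (i l : ℕ) (w : ℕ → ℂ) :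
    rowSum (matA2 f i (l + 1)) w ⟨l, by omega⟩ =
      rowSum (matA2 f i l) w (Fin.last l) + w (l + 1) := by
  refine (rowSum_glue_mid (matA2 f i l) (block2 f (i + l)) w).trans ?_
  simp [block2]

theorem rowSum_matA2_succ_last (i l : ℕ) (w : ℕ → ℂ) :
    rowSum (matA2 f i (l + 1)) w (Fin.last (l + 1)) =
      w l + eps f (i + l + 1) 2 * w (l + 1) := by
  refine (rowSum_glue_of_gt (matA2 f i l) (block2 f (i + l)) w (r := 0) zero_lt_one).trans ?_
  simp [block2, Fin.sum_univ_two]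

theorem rowSum_matA2_succ_of_lt (i l : ℕ) (w : ℕ → ℂ) {r : ℕ} (hr : r < l) :
    rowSum (matA2 f i (l + 1)) w ⟨r, by omega⟩ = rowSum (matA2 f i l) w ⟨r, by omega⟩ :=
  rowSum_glue_of_lt (matA2 f i l) (block2 f (i + l)) w hr

variable {f} {i : ℕ} {c : ℕ → ℂ} (h0 : c 0 = 0) (h1 : c 1 = 1)
  (hc : ∀ m, c (m + 2) = -c m - eps f (i + m) 2 * c (m + 1))

include h0 h1 hc in
-- Each row but the last solves for the next unknown by the recursion of `c`; the last row is left
-- with the obstruction `c (l + 2)`.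
theorem rowSum_matA2_of_rowSum_eq_zero (w : ℕ → ℂ) (l : ℕ)
    (hw : ∀ r : Fin (l + 1), r.1 < l → rowSum (matA2 f i l) w r = 0) :
    (∀ j ≤ l, w j = c (j + 1) * w 0) ∧
      rowSum (matA2 f i l) w (Fin.last l) = -c (l + 2) * w 0 := by
  induction l with
  | zero =>
    refine ⟨fun j hj => ?_, ?_⟩
    · obtain rfl : j = 0 := by omega
      rw [h1, one_mul]
    · rw [hc, h0, h1]
      simp [rowSum, matA2]
  | succ l ih =>
    obtain ⟨ih1, ih2⟩ := ih fun r hr => by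
      rw [← hw ⟨r.1, by omega⟩ (by simp; omega)]
      exact (rowSum_matA2_succ_of_lt f i l w hr).symm
    have hl := hw ⟨l, by omega⟩ (Nat.lt_succ_self l)
    rw [rowSum_matA2_succ_mid, ih2] at hl
    have hl1 : w (l + 1) = c (l + 2) * w 0 := by linear_combination hl
    refine ⟨fun j hj => ?_, ?_⟩
    · rcases hj.lt_or_eq with hj | rfl
      · exact ih1 j (by omega)
      · exact hl1
    · rw [rowSum_matA2_succ_last, hl1, ih1 l le_rfl, show l + 1 + 2 = (l + 1) + 2 from rfl,
        hc (l + 1)]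
      ring_nf

include h0 h1 hc in
theorem rowSum_matA2_eq_zero (l : ℕ) (r : Fin (l + 1)) (hr : r.1 < l) :
    rowSum (matA2 f i l) (fun j => c (j + 1)) r = 0 := by
  induction l with
  | zero => omega
  | succ l ih =>
    rcases (Nat.lt_succ_iff.1 hr).lt_or_eq with h | h
    · exact (rowSum_matA2_succ_of_lt f i l _ h).trans (ih ⟨r.1, by omega⟩ h)
    · rw [show r = ⟨l, by omega⟩ from Fin.ext h, rowSum_matA2_succ_mid, (rowSum_matA2_of_rowSum_eq_zero h0 h1 hc _ l ih).2, zero_add, h1]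
      ring

include h0 h1 hc in
theorem det_matA2_eq_zero_iff (l : ℕ) : (matA2 f i l).det = 0 ↔ c (l + 2) = 0 := by
  rw [det_eq_zero_iff_of_rowSum (matA2 f i l) (-c (l + 2)) (fun w hw => ?_)
    ⟨fun j => c (j + 1), h1, fun r hr => rowSum_matA2_eq_zero h0 h1 hc l r hr⟩, neg_eq_zero]
  obtain ⟨hj, hl⟩ := rowSum_matA2_of_rowSum_eq_zero h0 h1 hc w l hw
  exact ⟨hl, fun hw0 j hj' => by rw [hj j hj', hw0, mul_zero]⟩

end Two

/-! ### The case $d>2$ -/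

section Many

variable {d : ℕ} (hd : 2 < d) (i m : ℕ) (w : ℕ → ℂ)

include hd

theorem rowSum_matAd_succ_of_lt {r : ℕ} (hr : r < d * m) :
    rowSum (matAd f d i (m + 1)) w ⟨r, by rw [Nat.mul_succ]; omega⟩ =
      rowSum (matAd f d i m) w ⟨r, by omega⟩ :=
  rowSum_glue_of_lt (matAd f d i m) (block f d (i + 2 * m)) w hr

theorem rowSum_matAd_succ_mid :
    rowSum (matAd f d i (m + 1)) w ⟨d * m, by rw [Nat.mul_succ]; omega⟩ =
      rowSum (matAd f d i m) w (Fin.last (d * m)) + w (d * m + (d - 1)) := by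
  refine (rowSum_glue_mid (matAd f d i m) (block f d (i + 2 * m)) w).trans ?_
  congr 1
  rw [Fintype.sum_eq_single ⟨d - 2, by omega⟩]
  · simp [block, show d - 1 ≠ 0 by omega, show d - 1 + 1 = d by omega,
      show d - 2 + 1 = d - 1 by omega]
  · intro c hc
    have : ¬ c.1 + 1 + 1 = d := fun h => hc (Fin.ext (by simp; omega))
    simp [block, this]

omit hd in
theorem rowSum_matAd_succ_of_succ_lt {r : ℕ} (hr : r + 2 < d) :
    rowSum (matAd f d i (m + 1)) w ⟨d * m + (r + 1), by rw [Nat.mul_succ]; omega⟩ =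
      w (d * m + r) + w (d * m + (r + 1)) := by
  refine (rowSum_glue_of_gt (matAd f d i m) (block f d (i + 2 * m)) w (r := r)
    (by omega)).trans ?_
  rw [Fintype.sum_eq_add ⟨r, by omega⟩ ⟨r + 1, by omega⟩
    (fun h => by simpa using congrArg Fin.val h)]
  · simp [block, show r + 1 + 1 < d by omega]
  · rintro c ⟨h1, h2⟩
    have h1 : c.1 ≠ r := fun h => h1 (Fin.ext h)
    have h2 : c.1 ≠ r + 1 := fun h => h2 (Fin.ext h)
    simp [block, show r + 1 + 1 < d by omega, h1, h2]

theorem rowSum_matAd_succ_penultimate :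
    rowSum (matAd f d i (m + 1)) w ⟨d * m + (d - 1), by rw [Nat.mul_succ]; omega⟩ =
      w (d * m + (d - 2)) + w (d * m + d) := by
  have h := rowSum_glue_of_gt (matAd f d i m) (block f d (i + 2 * m)) w (r := d - 2) (by omega)
  simp only [show d - 2 + 1 = d - 1 by omega] at h
  refine h.trans ?_
  rw [Fintype.sum_eq_add ⟨d - 2, by omega⟩ ⟨d, by omega⟩ (by simp; omega)]
  · simp [block, show d - 1 ≠ 0 by omega, show d - 1 + 1 = d by omega,
      show d - 2 + 1 = d - 1 by omega]
  · rintro c ⟨h1, h2⟩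
    have h1 : c.1 + 1 ≠ d - 1 := fun h => h1 (Fin.ext (by simp; omega))
    have h2 : c.1 ≠ d := fun h => h2 (Fin.ext h)
    simp [block, show d - 1 ≠ 0 by omega, show d - 1 + 1 = d by omega, h1, h2]

theorem rowSum_matAd_succ_last :
    rowSum (matAd f d i (m + 1)) w (Fin.last (d * (m + 1))) =
      w (d * m + (d - 1)) + eps f (i + 2 * (m + 1)) d * w (d * m + d) := by
  have h := rowSum_glue_of_gt (matAd f d i m) (block f d (i + 2 * m)) w (r := d - 1) (by omega)
  simp only [show d - 1 + 1 = d by omega] at h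
  refine h.trans ?_
  rw [Fintype.sum_eq_add ⟨d - 1, by omega⟩ ⟨d, by omega⟩ (by simp; omega)]
  · simp [block, show d ≠ 0 by omega, show d - 1 + 1 = d by omega, mul_add, add_assoc]
  · rintro c ⟨h1, h2⟩
    have h1 : c.1 + 1 ≠ d := fun h => h1 (Fin.ext (by simp; omega))
    have h2 : c.1 ≠ d := fun h => h2 (Fin.ext h)
    simp [block, show d ≠ 0 by omega, h1, h2]

omit hd

variable {f} {i} {c : ℕ → ℂ} (h0 : c 0 = 0)
  (hc : ∀ m, c (m + 1) = -c m - eps f (i + 2 * m) d * ((-1) ^ (d - 1)) ^ m)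

include hd h0 hc in
-- In each block the columns other than $d-1$ carry only a sign, multiplied by $(-1)^{d-1}$ from one
-- shared column to the next. Column $d-1$ carries the accumulated value `c (m + 1)`, passed on from
-- the shared row to the last row of the block.
theorem rowSum_matAd_of_rowSum_eq_zero
    (hw : ∀ r : Fin (d * m + 1), r.1 < d * m → rowSum (matAd f d i m) w r = 0) :
    w (d * m) = ((-1) ^ (d - 1)) ^ m * w 0 ∧
      rowSum (matAd f d i m) w (Fin.last (d * m)) = -c (m + 1) * w 0 ∧
      (w 0 = 0 → ∀ j ≤ d * m, w j = 0) := by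
  induction m with
  | zero =>
    refine ⟨by simp, ?_, fun h j hj => ?_⟩
    · rw [hc, h0]
      simp [rowSum, matAd]
    · obtain rfl : j = 0 := by omega
      exact h
  | succ m ih =>
    have hm : d * (m + 1) = d * m + d := Nat.mul_succ d m
    obtain ⟨ih1, ih2, ih3⟩ := ih fun r hr => by
      rw [← hw ⟨r.1, by omega⟩ (by simp; omega)]
      exact (rowSum_matAd_succ_of_lt f hd i m w hr).symm
    have hmid := hw ⟨d * m, by omega⟩ (by simp; omega)
    rw [rowSum_matAd_succ_mid f hd, ih2] at hmid
    -- This row skips column $d-1$, linking columns $d-2$ and $d$ directly.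
    have hpen := hw ⟨d * m + (d - 1), by omega⟩ (by simp; omega)
    rw [rowSum_matAd_succ_penultimate f hd] at hpen
    have hr : ∀ r, r + 1 < d → w (d * m + r) = (-1) ^ r * w (d * m) := by
      intro r
      induction r with
      | zero => simp
      | succ r ihr =>
        intro hr
        have := hw ⟨d * m + (r + 1), by omega⟩ (by simp; omega)
        rw [rowSum_matAd_succ_of_succ_lt f i m w hr, ihr (by omega)] at this
        rw [pow_succ]
        linear_combination this
    have hlast : w (d * m + d) = ((-1) ^ (d - 1)) ^ (m + 1) * w 0 := by
      rw [hr (d - 2) (by omega), ih1] at hpen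
      have e : ((-1 : ℂ)) ^ (d - 1) = (-1) ^ (d - 2) * (-1) := by
        rw [← pow_succ, show d - 2 + 1 = d - 1 by omega]
      rw [pow_succ]
      nth_rewrite 2 [e]
      linear_combination hpen
    refine ⟨by rw [hm, hlast], ?_, fun hw0 j hj => ?_⟩
    · rw [rowSum_matAd_succ_last f hd, hlast, hc (m + 1)]
      linear_combination hmid
    · rw [hm] at hj
      rcases Nat.le_total j (d * m) with h | h
      · exact ih3 hw0 j h
      · obtain ⟨r, rfl⟩ := Nat.exists_eq_add_of_le h
        rcases Nat.lt_or_ge (r + 1) d with h1 | h1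
        · rw [hr r h1, ih1, hw0, mul_zero, mul_zero]
        · rcases Nat.lt_or_ge r d with h2 | h2
          · obtain rfl : r = d - 1 := by omega
            rw [hw0, mul_zero, zero_add] at hmid
            exact hmid
          · obtain rfl : r = d := by omega
            rw [hlast, hw0, mul_zero]

/-- The candidate for a kernel vector of `A_{i,i+2m}^d`. -/
noncomputable def kernelSeq (d : ℕ) (c : ℕ → ℂ) (j : ℕ) : ℂ :=
  if j % d + 1 = d then c (j / d + 1) else ((-1) ^ (d - 1)) ^ (j / d) * (-1) ^ (j % d)

include hd in
theorem kernelSeq_of_lt {r : ℕ} (hr : r + 1 < d) :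
    kernelSeq d c (d * m + r) = ((-1) ^ (d - 1)) ^ m * (-1) ^ r := by
  rw [kernelSeq, Nat.mul_add_mod, Nat.mod_eq_of_lt (by omega), Nat.mul_add_div (by omega),
    Nat.div_eq_of_lt (by omega), if_neg (by omega), add_zero]

include hd in
theorem kernelSeq_pred : kernelSeq d c (d * m + (d - 1)) = c (m + 1) := by
  rw [kernelSeq, Nat.mul_add_mod, Nat.mod_eq_of_lt (by omega), Nat.mul_add_div (by omega),
    Nat.div_eq_of_lt (by omega), if_pos (by omega), add_zero]

include hd h0 hc in
theorem rowSum_matAd_kernelSeq {r : ℕ} (hr : r < d * m) :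
    rowSum (matAd f d i m) (kernelSeq d c) ⟨r, by omega⟩ = 0 := by
  induction m generalizing r with
  | zero => omega
  | succ m ih =>
    have hm : d * (m + 1) = d * m + d := Nat.mul_succ d m
    rcases Nat.lt_or_ge r (d * m) with h | h
    · exact (rowSum_matAd_succ_of_lt f hd i m _ h).trans (ih h)
    obtain ⟨q, rfl⟩ := Nat.exists_eq_add_of_le h
    rcases Nat.eq_zero_or_pos q with rfl | hq0
    · have h1 : kernelSeq d c 0 = 1 := by
        simpa using kernelSeq_of_lt (c := c) hd 0 (r := 0) (by omega)
      refine (rowSum_matAd_succ_mid f hd i m _).trans ?_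
      rw [(rowSum_matAd_of_rowSum_eq_zero hd m _ h0 hc fun r hr => ih hr).2.1, kernelSeq_pred hd, h1]
      ring
    obtain ⟨q, rfl⟩ : ∃ q', q = q' + 1 := ⟨q - 1, by omega⟩
    rcases Nat.lt_or_ge (q + 2) d with h2 | h2
    · refine (rowSum_matAd_succ_of_succ_lt f i m _ h2).trans ?_
      rw [kernelSeq_of_lt hd _ (by omega), kernelSeq_of_lt hd _ (by omega)]
      ring
    · obtain rfl : q = d - 2 := by omega
      simp only [show d - 2 + 1 = d - 1 by omega]
      refine (rowSum_matAd_succ_penultimate f hd i m _).trans ?_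
      have h3 := kernelSeq_of_lt (c := c) hd (m + 1) (r := 0) (by omega)
      rw [hm, add_zero] at h3
      rw [h3, kernelSeq_of_lt hd _ (by omega), pow_succ]
      have e : ((-1 : ℂ)) ^ (d - 1) = (-1) ^ (d - 2) * (-1) := by
        rw [← pow_succ, show d - 2 + 1 = d - 1 by omega]
      nth_rewrite 3 [e]
      ring

include hd h0 hc in
theorem det_matAd_eq_zero_iff : (matAd f d i m).det = 0 ↔ c (m + 1) = 0 := by
  rw [det_eq_zero_iff_of_rowSum (matAd f d i m) (-c (m + 1))
    (fun w hw => (rowSum_matAd_of_rowSum_eq_zero hd m w h0 hc hw).2)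
    ⟨kernelSeq d c, ?_, fun r hr => rowSum_matAd_kernelSeq hd m h0 hc hr⟩, neg_eq_zero]
  simpa using kernelSeq_of_lt (c := c) hd 0 (r := 0) (by omega)

end Many

end Matrices

section Filtration

/-! ### The filtration -/

theorem coeff_phi {n : ℕ} (f : Potential n) (i m : ℕ) :
    PowerSeries.coeff m (phi f i) = eps f i (m + 1) := PowerSeries.coeff_mk _ _

theorem coeff_potential_eq_zero {n : ℕ} {p : ℕ → ℕ∞} {k : Param n} (hk : k ∈ paramSpace n p)
    {i j : ℕ} (hj : (j : ℕ∞) < p i) : (potential k).coeff i j = 0 := by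
  by_cases h : (1 ≤ i ∧ i < 2 * n) ∧ 2 ≤ j
  · rw [coeff_potential k ⟨(⟨i, h.1⟩, j), h.2⟩]
    exact hk _ hj
  · exact dif_neg h

theorem X_pow_dvd_phi {n : ℕ} {p : ℕ → ℕ∞} {k : Param n} (hk : k ∈ paramSpace n p)
    {i D : ℕ} (hD : ((D + 1 : ℕ) : ℕ∞) ≤ p i) : PowerSeries.X ^ D ∣ phi (potential k) i := by
  rw [PowerSeries.X_pow_dvd_iff]
  intro m hm
  rw [coeff_phi, eps, coeff_potential_eq_zero hk, mul_zero]
  exact lt_of_lt_of_le (by exact_mod_cast Nat.succ_lt_succ hm) hD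

theorem dMin_odd (p : ℕ → ℕ∞) {s t : ℕ} (hs : 1 ≤ s) (hst : s ≤ t) :
    dMin p (2 * s - 1) (2 * t - 1) =
      (Finset.range (t - s + 1)).inf fun m => p (2 * s - 1 + 2 * m) := by
  rw [dMin, if_neg (by rw [Nat.not_odd_iff_even]; exact ⟨t - s, by omega⟩),
    show (2 * t - 1 - (2 * s - 1)) / 2 = t - s by omega]

/-- The power series in one variable whose order is the invariant `N_{st}(f(k))`. -/
noncomputable def reducedGV {n : ℕ} (s t : ℕ) (k : Param n) : PowerSeries ℂ :=
  reduced (fun i => phi (potential k) (2 * s - 2 + i)) (2 * (t - s + 1))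

/-- The parameters in `M_p` for which the first `N` coefficients of `reducedGV` vanish. -/
noncomputable def orderLocus (n : ℕ) (p : ℕ → ℕ∞) (s t N : ℕ) : Set (Param n) :=
  {k | k ∈ paramSpace n p ∧ ∀ j < N, PowerSeries.coeff j (reducedGV s t k) = 0}

/-- Polynomial functions on $\mathsf M_{\mathbf p}$ form the range of an evaluation homomorphism. It
contains the coefficients of every $\varphi_i$, each being zero or a multiple of a coordinate, hence
also those of `reducedGV`. -/
theorem exists_polynomials_orderLocus (n : ℕ) (p : ℕ → ℕ∞) (s t N : ℕ) :
    ∃ S : Set (MvPolynomial (CoordP n p) ℂ), S.Finite ∧ orderLocus n p s t N = zeroLocus S := by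
  let ev : MvPolynomial (CoordP n p) ℂ →+* (paramSpace n p → ℂ) :=
    RingHom.pi fun k => MvPolynomial.eval fun c => k.1 c.1
  have hev : ∀ P k, ev P k = MvPolynomial.eval (fun c => k.1 c.1) P := fun _ _ => rfl
  have key : ∀ j, (fun k : paramSpace n p => PowerSeries.coeff j (reducedGV s t k.1)) ∈
      ev.range := by
    refine fun j => coeff_reduced_mem ev.range
      (φ := fun (k : paramSpace n p) i => phi (potential k.1) (2 * s - 2 + i))
      (fun k i => phi_coeff_zero _ _) (fun i N => ?_) _ j
    simp only [coeff_phi, eps]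
    by_cases h : (1 ≤ 2 * s - 2 + i ∧ 2 * s - 2 + i < 2 * n) ∧ 2 ≤ N + 1
    · by_cases h' : p (2 * s - 2 + i) ≤ ((N + 1 : ℕ) : ℕ∞)
      · refine ⟨MvPolynomial.C ((N + 1 : ℕ) : ℂ) *
          MvPolynomial.X ⟨⟨(⟨2 * s - 2 + i, h.1⟩, N + 1), h.2⟩, h'⟩, ?_⟩
        funext k
        have := coeff_potential k.1 ⟨(⟨2 * s - 2 + i, h.1⟩, N + 1), h.2⟩
        simp only at this
        rw [this, hev, map_mul, MvPolynomial.eval_C, MvPolynomial.eval_X]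
      · convert zero_mem ev.range with k
        rw [coeff_potential_eq_zero k.2 (not_le.1 h'), mul_zero]
        rfl
    · convert zero_mem ev.range with k
      rw [Potential.coeff, dif_neg h, mul_zero]
      rfl
  choose P hP using key
  refine ⟨P '' Set.Iio N, (Set.finite_Iio N).image P, ?_⟩
  ext k
  refine and_congr_right fun hk => ?_
  rw [Set.forall_mem_image]
  refine forall₂_congr fun j _ => ?_
  have : MvPolynomial.eval (fun c : CoordP n p => k c.1) (P j) =
      PowerSeries.coeff j (reducedGV s t k) := congrFun (hP j) ⟨k, hk⟩
  rw [this]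

/-! ### The first steps, strictness and the case $s=t$ -/

section Locus

variable {n : ℕ} {p : ℕ → ℕ∞} {s t d : ℕ}

theorem X_pow_dvd_phi_of_dMin (hs : 1 ≤ s) (hst : s ≤ t)
    (hd : ((d : ℕ) : ℕ∞) ≤ dMin p (2 * s - 1) (2 * t - 1)) (hd2 : 2 ≤ d)
    {k : Param n} (hk : k ∈ paramSpace n p) (q : ℕ) (hq : q < t - s + 1) :
    PowerSeries.X ^ (d - 1) ∣ phi (potential k) (2 * s - 2 + (2 * q + 1)) := by
  apply X_pow_dvd_phi hk
  rw [dMin_odd p hs hst, Finset.le_inf_iff] at hd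
  have := hd q (Finset.mem_range.2 hq)
  rwa [show d - 1 + 1 = d by omega, show 2 * s - 2 + (2 * q + 1) = 2 * s - 1 + 2 * q by omega]

theorem orderLocus_eq_paramSpace (hs : 1 ≤ s) (hst : s ≤ t)
    (hd : dMin p (2 * s - 1) (2 * t - 1) = d) (hd2 : 2 ≤ d) :
    orderLocus n p s t (d - 1) = paramSpace n p := by
  ext k
  refine and_iff_left_of_imp fun hk => ?_
  exact PowerSeries.X_pow_dvd_iff.1 (X_pow_dvd_reduced (fun i => phi_coeff_zero _ _)
    (X_pow_dvd_phi_of_dMin hs hst hd.ge hd2 hk) _ le_rfl)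

theorem det_matA_eq_zero_iff (hs : 1 ≤ s) (hst : s ≤ t)
    (hd : dMin p (2 * s - 1) (2 * t - 1) = d) (hd2 : 2 ≤ d)
    {k : Param n} (hk : k ∈ paramSpace n p) :
    (matA (potential k) d (2 * s - 1) (2 * t - 1)).2.det = 0 ↔
      PowerSeries.coeff (d - 1) (reducedGV s t k) = 0 := by
  have hφ : ∀ i, PowerSeries.constantCoeff (phi (potential k) (2 * s - 2 + i)) = 0 :=
    fun i => phi_coeff_zero _ _
  by_cases h : d = 2
  · subst h
    rw [matA, if_pos rfl, show 2 * t - 1 - (2 * s - 1) = 2 * (t - s) by omega]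
    refine det_matA2_eq_zero_iff (c := fun m => PowerSeries.coeff 1
      (reduced (fun i => phi (potential k) (2 * s - 2 + i)) m)) ?_ ?_ ?_ (2 * (t - s))
    · simp [reduced]
    · simp [reduced]
    · intro m
      rw [coeff_one_reduced hφ, coeff_phi, show 2 * s - 2 + (m + 1) = 2 * s - 1 + m by omega]
  · rw [matA, if_neg h, show (2 * t - 1 - (2 * s - 1)) / 2 = t - s by omega]
    -- The matrix lemma needs the recursion for all indices, but the coefficients of the reduced
    -- system are only known to satisfy it up to $t-s+1$; hence a separate sequence.
    let c : ℕ → ℂ := fun q => Nat.rec 0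
      (fun m x => -x - eps (potential k) (2 * s - 1 + 2 * m) d * ((-1) ^ (d - 1)) ^ m) q
    have hc : ∀ q ≤ t - s + 1, c q = PowerSeries.coeff (d - 1)
        (reduced (fun i => phi (potential k) (2 * s - 2 + i)) (2 * q)) := by
      intro q
      induction q with
      | zero => simp [c, reduced]
      | succ q ih =>
        intro hq
        rw [coeff_reduced_even hφ (by omega) (X_pow_dvd_phi_of_dMin hs hst hd.ge hd2 hk) hq,
          ← ih (by omega), coeff_phi, show d - 1 + 1 = d by omega,
          show 2 * s - 2 + (2 * q + 1) = 2 * s - 1 + 2 * q by omega]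
    rw [det_matAd_eq_zero_iff (c := c) (by omega) (t - s) rfl fun _ => rfl, hc _ le_rfl]
    rfl

/-- Every order that is at least `d - 1` occurs. -/
theorem exists_coeff_reducedGV_ne_zero (hs : 1 ≤ s) (hst : s ≤ t) (ht : t ≤ n)
    (hd : dMin p (2 * s - 1) (2 * t - 1) = d) {N : ℕ} (hN : d ≤ N + 1) (hN0 : N ≠ 0) :
    ∃ k ∈ paramSpace n p, (∀ j < N, PowerSeries.coeff j (reducedGV s t k) = 0) ∧
      PowerSeries.coeff N (reducedGV s t k) ≠ 0 := by
  -- The index `r` marks a loop where the minimum $d$ is attained, so its coefficient of degree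
  -- $N+1\ge d$ is free in $\mathsf M_{\mathbf p}$.
  obtain ⟨r, hr, hpr⟩ := Finset.exists_mem_eq_inf (Finset.range (t - s + 1))
    ⟨0, by simp⟩ fun m => p (2 * s - 1 + 2 * m)
  rw [← dMin_odd p hs hst, hd] at hpr
  rw [Finset.mem_range] at hr
  let k : Param n := fun c => if c.1.1.1 = 2 * s - 1 + 2 * r ∧ c.1.2 = N + 1 then 1 else 0
  have hk : k ∈ paramSpace n p := by
    intro c hc
    refine if_neg fun h => ?_
    rw [h.1, h.2, ← hpr] at hc
    exact absurd hN (not_le.2 (by exact_mod_cast hc))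
  have hcoeff : ∀ i j, (potential k).coeff i j =
      if i = 2 * s - 1 + 2 * r ∧ j = N + 1 then 1 else 0 := by
    intro i j
    by_cases h : (1 ≤ i ∧ i < 2 * n) ∧ 2 ≤ j
    · exact coeff_potential k ⟨(⟨i, h.1⟩, j), h.2⟩
    · rw [Potential.coeff, dif_neg h, if_neg]
      omega
  obtain ⟨u, hu, h⟩ := reduced_of_single
    (φ := fun i => phi (potential k) (2 * s - 2 + i)) (r := r) (N := N) (c := ((N + 1 : ℕ) : ℂ))
    (Nat.cast_ne_zero.2 (Nat.succ_ne_zero N)) hN0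
    (fun i hi => by
      ext m
      rw [coeff_phi, eps, hcoeff, if_neg (by omega), mul_zero, map_zero])
    (by
      ext m
      rw [coeff_phi, eps, hcoeff, map_smul, PowerSeries.coeff_X_pow]
      by_cases hm : m = N
      · rw [if_pos (by omega), if_pos hm, hm, smul_eq_mul]
      · rw [if_neg (by omega), if_neg hm, mul_zero, smul_zero]) hr
  change reducedGV s t k = _ at h
  refine ⟨k, hk, fun j hj => ?_, ?_⟩
  · rw [h, map_smul, PowerSeries.coeff_X_pow, if_neg hj.ne, smul_zero]
  · rw [h, map_smul, PowerSeries.coeff_X_pow, if_pos rfl]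
    simpa using hu

theorem reducedGV_self (s : ℕ) (k : Param n) :
    reducedGV s s k = -phi (potential k) (2 * s - 2 + 1) := by
  have hs : 2 * (s - s + 1) = 0 + 2 := by omega
  rw [reducedGV, hs, reduced]
  simp only [zero_add, reduced]
  rw [PowerSeries.X_subst, neg_zero, zero_sub]

/-- Here `reducedGV` is $-\varphi_{2s-1}$, whose coefficient of $X^j$ is $-(j+1)k_{2s-1,j+1}$; the
degree shift turns $j<d+i$ into an upper bound $d+i$ on the index of $k$. -/
theorem orderLocus_self (hs : 1 ≤ s) (hd : p (2 * s - 1) = d) (i : ℕ) :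
    orderLocus n p s s (d + i) = {k | k ∈ paramSpace n p ∧ ∀ c : Coord n,
      c.1.1.1 = 2 * s - 1 → p (2 * s - 1) ≤ (c.1.2 : ℕ∞) →
        (c.1.2 : ℕ∞) ≤ p (2 * s - 1) + (i : ℕ∞) → k c = 0} := by
  ext k
  refine and_congr_right fun hk => ?_
  have hj : ∀ j, PowerSeries.coeff j (reducedGV s s k) =
      -((j + 1 : ℕ) * (potential k).coeff (2 * s - 1) (j + 1)) := by
    intro j
    rw [reducedGV_self, map_neg, coeff_phi, eps, show 2 * s - 2 + 1 = 2 * s - 1 by omega]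
  simp only [hj, neg_eq_zero, mul_eq_zero, Nat.cast_eq_zero, Nat.succ_ne_zero, false_or]
  rw [hd]
  constructor
  · intro H c hc _ h2
    have hle : c.1.2 ≤ d + i := by exact_mod_cast h2
    have hc2 := c.2
    have := H (c.1.2 - 1) (by omega)
    rwa [show c.1.2 - 1 + 1 = c.1.2 by omega, ← hc, coeff_potential] at this
  · intro H j hj
    by_cases h : (1 ≤ 2 * s - 1 ∧ 2 * s - 1 < 2 * n) ∧ 2 ≤ j + 1
    · rcases Nat.lt_or_ge (j + 1) d with h' | h'
      · exact coeff_potential_eq_zero hk (by rw [hd]; exact_mod_cast h')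
      · refine (coeff_potential k ⟨(⟨2 * s - 1, h.1⟩, j + 1), h.2⟩).trans (H _ rfl ?_ ?_)
        · exact_mod_cast h'
        · exact_mod_cast Nat.succ_le_of_lt hj
    · exact dif_neg h

end Locus

end Filtration

end TypeA

theorem mainTheorem5 (n : ℕ) (p : ℕ → ℕ∞) (hp : ∀ i, 1 ≤ i → i < 2 * n → 2 ≤ p i)
    (s t : ℕ) (hs : 1 ≤ s) (hst : s ≤ t) (ht : t ≤ n) :
    (∀ d : ℕ, TypeA.dMin p (2 * s - 1) (2 * t - 1) = d →
      ∃ M : ℕ → Set (TypeA.Param n),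
        M 1 = TypeA.paramSpace n p ∧
        (∀ i, 1 ≤ i → M (i + 1) ⊂ M i) ∧
        (∀ i, 1 ≤ i → ∀ k ∈ M i \ M (i + 1), ∀ e < 2 * n,
          TypeA.genGV (TypeA.potential k) e s t = ((d + i - 2 : ℕ) : ℕ∞)) ∧
        (∀ i, 1 ≤ i → ∃ S : Set (MvPolynomial (TypeA.CoordP n p) ℂ),
          S.Finite ∧ M i = TypeA.zeroLocus S) ∧
        M 2 = {k | k ∈ TypeA.paramSpace n p ∧
          (TypeA.matA (TypeA.potential k) d (2 * s - 1) (2 * t - 1)).2.det = 0} ∧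
        (s = t → ∀ i, 2 ≤ i →
          M i = {k | k ∈ TypeA.paramSpace n p ∧ ∀ c : TypeA.Coord n, c.1.1.1 = 2 * s - 1 →
            p (2 * s - 1) ≤ (c.1.2 : ℕ∞) → (c.1.2 : ℕ∞) ≤ p (2 * s - 1) + ((i - 2 : ℕ) : ℕ∞) →
              k c = 0})) ∧
    (TypeA.dMin p (2 * s - 1) (2 * t - 1) = ⊤ →
      ∀ k ∈ TypeA.paramSpace n p, ∀ e < 2 * n,
        TypeA.genGV (TypeA.potential k) e s t = ⊤) := by
  have hGV : ∀ (k : TypeA.Param n) (e : ℕ),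
      TypeA.genGV (TypeA.potential k) e s t = (TypeA.reducedGV s t k).order :=
    fun k e => TypeA.genGV_eq_order _ e hs hst
  refine ⟨fun d hd => ?_, fun htop k hk e _ => ?_⟩
  · have hd2 : 2 ≤ d := by
      have h : ((2 : ℕ) : ℕ∞) ≤ d := by
        rw [← hd, TypeA.dMin_odd p hs hst, Finset.le_inf_iff]
        intro m hm
        rw [Finset.mem_range] at hm
        exact hp _ (by omega) (by omega)
      exact_mod_cast h
    have h1 := TypeA.orderLocus_eq_paramSpace (n := n) hs hst hd hd2
    -- At $i=1$ the condition concerns the first $d-1$ coefficients, which vanish on all of $\mathsf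
    -- M_{\mathbf p}$; each further step imposes one more.
    refine ⟨fun i => TypeA.orderLocus n p s t (d + i - 2), ?_, fun i hi => ?_, ?_,
      fun i _ => TypeA.exists_polynomials_orderLocus n p s t _, ?_, ?_⟩
    · rw [← h1]
      rfl
    · have hsub : TypeA.orderLocus n p s t (d + (i + 1) - 2) ⊆
          TypeA.orderLocus n p s t (d + i - 2) :=
        fun k hk => ⟨hk.1, fun j hj => hk.2 j (by omega)⟩
      refine (Set.ssubset_iff_of_subset hsub).2 ?_
      obtain ⟨k, hk, hk1, hk2⟩ := TypeA.exists_coeff_reducedGV_ne_zero hs hst ht hd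
        (N := d + i - 2) (by omega) (by omega)
      exact ⟨k, ⟨hk, hk1⟩, fun h => hk2 (h.2 _ (by omega))⟩
    -- Leaving $M_{i+1}$ while staying in $M_i$ means that the coefficient of degree $d+i-2$ is the
    -- first non-zero one.
    · rintro i hi k ⟨hk, hk'⟩ e -
      rw [hGV, PowerSeries.order_eq_nat]
      refine ⟨fun h0 => hk' ⟨hk.1, fun j hj => ?_⟩, hk.2⟩
      rcases Nat.lt_or_ge j (d + i - 2) with h | h
      · exact hk.2 j h
      · rwa [show j = d + i - 2 by omega]
    · ext k
      refine and_congr_right fun hk => ?_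
      rw [TypeA.det_matA_eq_zero_iff hs hst hd hd2 hk]
      refine ⟨fun h => h _ (by omega), fun h j hj => ?_⟩
      rcases Nat.lt_or_ge j (d - 1) with h' | h'
      · exact (h1.ge hk).2 j h'
      · rwa [show j = d - 1 by omega]
    · rintro rfl i hi
      obtain ⟨i, rfl⟩ := Nat.exists_eq_add_of_le hi
      have hps : p (2 * s - 1) = d := by
        rw [← hd, TypeA.dMin_odd p hs le_rfl]
        simp
      rw [Nat.add_sub_cancel_left, ← TypeA.orderLocus_self hs hps i,
        show d + i = d + (2 + i) - 2 by omega]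
  · rw [hGV, PowerSeries.order_eq_top]
    refine TypeA.reduced_even_eq_zero (fun i => TypeA.phi_coeff_zero _ _) (fun q hq => ?_) _ le_rfl
    ext m
    rw [TypeA.coeff_phi, TypeA.eps, TypeA.coeff_potential_eq_zero hk, mul_zero, map_zero]
    rw [TypeA.dMin_odd p hs hst, Finset.inf_eq_top_iff] at htop
    have := htop q (Finset.mem_range.2 hq)
    rw [show 2 * s - 2 + (2 * q + 1) = 2 * s - 1 + 2 * q by omega, this]
    exact ENat.natCast_lt_top _
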